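/- Let $\mathcal P_Y,\mathcal P_Z,\mathcal P$ be the unital $*$-algebras over $\mathbb C$ freely generated by the Hermitian non-commuting variables $y=(y_1,\dots,y_c)$, $z=(z_1,\dots,z_q)$ and $x=(y,z)$, respectively. Let $f\in\mathcal P$, $\tilde g_i,\tilde h_j\in\mathcal P_Y$ and $\hat g_i,\hat h_j\in\mathcal P_Z$ ($1\le i\le m_Z$, respectively $1\le j\le m'_Z$, for the last two families; all families are finite) be Hermitian. Consider the non-commutative polynomial optimization problem of minimizing $\sigma(f)$ over all linear functionals $\sigma:\mathcal P\to\mathbb C$ with $\sigma(1)=1$, $\sigma(pp^*)\ge 0$ for all $p\in\mathcal P$, which are compatible with the constraints $$\tilde g_i(y)\ge 0,\quad \tilde h_j(y)=0,\quad \hat g_i(z)\ge 0,\quad \hat h_j(z)=0,\quad [y_r,z_s]=0\ \ \forall r,s .$$ Here a functional $\mu$ is compatible with $g\ge 0$ if $\mu(pgp^*)\ge 0$ for all polynomials $p$, and with $h=0$ if $\mu(s\,h\,t)=0$ for all polynomials $s,t$; the relation $[y_r,z_s]=0$ is written with the Hermitian polynomial $i[y_r,z_s]$. A linear functional $\mu$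 is positive if it is Hermitian, $\mu(p^*)=\overline{\mu(p)}$, and $\mu(pp^*)\ge 0$ for all $p$. For constraints $\{g_i\ge 0\}$, $\{h_j=0\}$ a polynomial is SOS if it is a finite sum of terms $s^*s$, $s^*g_is$ and $s\,h_jt^*+t\,h_js^*$. The constraints are Archimedean if $K-\sum_k x_k^2$ is SOS for some real $K>0$. The gradient $\nabla_x p(t)$ is the part of $p(x+\epsilon t)$ linear in $\epsilon$, and $\nabla_z$ is the gradient with respect to $z$ only. Assume that (a) the constraints of the whole problem displayed above are Archimedean; (b) the constraints $\{\hat g_i(z)\ge0\}_i\cup\{\hat h_j(z)=0\}_j$ satisfy ncMFCQ in $\mathcal P_Z$. That is, with $\mathcal J\subset\mathcal P_Z$ the two-sided ideal generated by $\{\hat h_j\}_j$: (b1) the equality constraints have linearly independent gradients: there are $q$-tuples $P_0(z,w),\dots,P_{m'_Z}(z,w)$ of Hermitian polynomials in the variables $z$ and $w=(w_1,\dots,w_q)$, linear in $w$, such that for all $p\in\mathcal P_Z^{\times q}$: $\sum_{j=0}^{m'_Z} P_j(z,p)-p\in\mathcal J^{\times q}$; $\nabla_z\hat h_j(P_k(z,p))\in\mathcal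 J$ for all $1\le j\le m'_Z$ and $0\le k\le m'_Z$ with $k\ne j$; and, for $1\le j\le m'_Z$ and $1\le k\le q$, $(P_j(z,p))_k-\sum_l\big(\beta^+_{jkl}\nabla_z\hat h_j(p)(\beta^-_{jkl})^*+\beta^-_{jkl}\nabla_z\hat h_j(p)(\beta^+_{jkl})^*\big)\in\mathcal J$, for finitely many polynomials $\beta^\pm_{jkl}\in\mathcal P_Z$ that do not depend on $p$; (b2) there are a real $r>0$, a tuple $t$ of $q$ Hermitian polynomials in $\mathcal P_Z$ and $s_i\in\mathcal P_Z$ such that $\nabla_z\hat g_i(t)+s_i\hat g_i+\hat g_is_i^*-r$ is SOS (in $\mathcal P_Z$, with respect to the constraints $\hat g,\hat h$) for all $i$, and $\nabla_z\hat h_j(t)\in\mathcal J$ for all $j$. Then, for every minimizer $\sigma$ of the problem, there exist positive linear functionals $\mu_i:\mathcal P_Z\to\mathbb C$ ($1\le i\le m_Z$) and $\lambda_j^+,\lambda_j^-:\mathcal P_Z\to\mathbb C$ ($1\le j\le m'_Z$), all of them compatible with $\{\hat g_k(z)\ge0\}_k\cup\{\hat h_l(z)=0\}_l$, such that $\mu_i(\hat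 g_i)=0$ for all $i$ and $$\sigma\big(\nabla_z f(p)\big)-\sum_i\mu_i\big(\nabla_z\hat g_i(p)\big)-\sum_j\lambda_j\big(\nabla_z\hat h_j(p)\big)=0\qquad\forall p\in\mathcal P_Z^{\times q},$$ where $\lambda_j=\lambda_j^+-\lambda_j^-$. -/

import Mathlib

open scoped ComplexOrder

noncomputable section

/-- Complex polynomials in the non-commuting Hermitian variables `x`, `x ∈ X`: the unital
`*`-algebra over `ℂ` freely generated by self-adjoint symbols. (This is a synonym of the free
algebra, because the star of Mathlib on `FreeAlgebra ℂ X` does not conjugate coefficients.) -/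
def NCPoly (X : Type*) : Type _ := FreeAlgebra ℂ X

namespace NCPoly

variable {X : Type*}

instance : Ring (NCPoly X) := inferInstanceAs (Ring (FreeAlgebra ℂ X))

instance : Algebra ℂ (NCPoly X) := inferInstanceAs (Algebra ℂ (FreeAlgebra ℂ X))

/-- The variable with index `k`. -/
def var (k : X) : NCPoly X := FreeAlgebra.ι ℂ k

/-- Evaluation of a polynomial at a tuple of elements of a complex algebra. -/
def eval {A : Type*} [Ring A] [Algebra ℂ A] (a : X → A) : NCPoly X →ₐ[ℂ] A :=
  FreeAlgebra.lift ℂ a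

@[simp]
theorem eval_var {A : Type*} [Ring A] [Algebra ℂ A] (a : X → A) (k : X) :
    eval a (var k) = a k :=
  FreeAlgebra.lift_ι_apply a k

theorem induction {C : NCPoly X → Prop} (hs : ∀ r : ℂ, C (algebraMap ℂ _ r))
    (hv : ∀ k, C (var k)) (hm : ∀ a b, C a → C b → C (a * b))
    (ha : ∀ a b, C a → C b → C (a + b)) (p : NCPoly X) : C p :=
  FreeAlgebra.induction (R := ℂ) (X := X) (motive := C) hs hv hm ha p

/-- Complex conjugation of all coefficients (words are left unchanged). -/
def conjCoeff : NCPoly X →+* NCPoly X :=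
  (FreeAlgebra.equivMonoidAlgebraFreeMonoid (R := ℂ) (X := X)).symm.toRingEquiv.toRingHom.comp
    ((MonoidAlgebra.mapRingHom (FreeMonoid X) (starRingEnd ℂ)).comp
      (FreeAlgebra.equivMonoidAlgebraFreeMonoid (R := ℂ) (X := X)).toRingEquiv.toRingHom)

/-- Reversal of all words (coefficients are left unchanged). -/
def revWords : NCPoly X →ₐ[ℂ] (NCPoly X)ᵐᵒᵖ := eval fun k => MulOpposite.op (var k)

/-- The involution `p ↦ p^*`: it conjugates coefficients and reverses words. -/
instance : Star (NCPoly X) := ⟨fun p => (revWords (conjCoeff p)).unop⟩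

theorem conjCoeff_var (k : X) : conjCoeff (var k) = var k := by
  refine (FreeAlgebra.equivMonoidAlgebraFreeMonoid (R := ℂ) (X := X)).symm_apply_eq.2 ?_
  have h1 : FreeAlgebra.equivMonoidAlgebraFreeMonoid (R := ℂ) (FreeAlgebra.ι ℂ k) =
      MonoidAlgebra.single (FreeMonoid.of k) 1 := by
    simp [FreeAlgebra.equivMonoidAlgebraFreeMonoid]
  refine Eq.trans ?_ h1.symm
  refine (congrArg (MonoidAlgebra.mapRingHom (FreeMonoid X) (starRingEnd ℂ)) h1).trans ?_
  simp

theorem conjCoeff_algebraMap (r : ℂ) :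
    conjCoeff (algebraMap ℂ (NCPoly X) r) = algebraMap ℂ (NCPoly X) (starRingEnd ℂ r) := by
  refine (FreeAlgebra.equivMonoidAlgebraFreeMonoid (R := ℂ) (X := X)).symm_apply_eq.2 ?_
  have h1 := (FreeAlgebra.equivMonoidAlgebraFreeMonoid (R := ℂ) (X := X)).commutes r
  have h2 := (FreeAlgebra.equivMonoidAlgebraFreeMonoid (R := ℂ) (X := X)).commutes
    (starRingEnd ℂ r)
  refine Eq.trans ?_ h2.symm
  refine (congrArg (MonoidAlgebra.mapRingHom (FreeMonoid X) (starRingEnd ℂ)) h1).trans ?_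
  simp

theorem star_def (p : NCPoly X) : star p = (revWords (conjCoeff p)).unop := rfl

@[simp]
theorem star_var (k : X) : star (var k) = var k := by
  simp [star_def, conjCoeff_var, revWords]

theorem star_algebraMap' (r : ℂ) :
    star (algebraMap ℂ (NCPoly X) r) = algebraMap ℂ (NCPoly X) (starRingEnd ℂ r) := by
  rw [star_def, conjCoeff_algebraMap, AlgHom.commutes]
  rfl

theorem star_add' (p q : NCPoly X) : star (p + q) = star p + star q := by
  simp [star_def]

theorem star_mul' (p q : NCPoly X) : star (p * q) = star q * star p := by
  simp [star_def]

instance : StarRing (NCPoly X) where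
  star_involutive p := by
    induction p using NCPoly.induction with
    | hs r => simp [star_algebraMap']
    | hv k => simp
    | hm a b ha hb => rw [star_mul', star_mul', ha, hb]
    | ha a b ha hb => rw [star_add', star_add', ha, hb]
  star_mul := star_mul'
  star_add := star_add'

instance : StarModule ℂ (NCPoly X) where
  star_smul r p := by
    rw [Algebra.smul_def, star_mul, star_algebraMap', Algebra.smul_def, Algebra.commutes]
    rfl

/-- Polynomials in part of the variables (or in renamed variables). -/
def rename {Y : Type*} (e : X → Y) : NCPoly X →ₐ[ℂ] NCPoly Y := eval fun k => var (e k)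

@[simp]
theorem rename_var {Y : Type*} (e : X → Y) (k : X) : rename e (var k) = var (e k) :=
  eval_var _ k

theorem rename_star {Y : Type*} (e : X → Y) (p : NCPoly X) :
    rename e (star p) = star (rename e p) := by
  induction p using NCPoly.induction with
  | hs r => rw [star_algebraMap', AlgHom.commutes, AlgHom.commutes, star_algebraMap']
  | hv k => simp
  | hm a b ha hb => rw [star_mul, map_mul, map_mul, star_mul, ha, hb]
  | ha a b ha hb => rw [star_add, map_add, map_add, star_add, ha, hb]

/-- The gradient `∇ₓ p(t)` of `p` at the tuple of variations `t`: substitute `x + ε t` for `x`,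
where `ε` is a central symbol with `ε² = 0`, and take the coefficient of `ε`. -/
def grad (p : NCPoly X) (t : X → NCPoly X) : NCPoly X :=
  (eval (A := DualNumber (NCPoly X))
    (fun k => TrivSqZeroExt.inl (var k) + TrivSqZeroExt.inr (t k)) p).snd

/-- The polynomials in the `2n` variables `x` (left copy) and `z` (right copy) that are linear
in `z`, i.e. the sums of terms `a(x) z_k b(x)`. -/
def linearInRight (X : Type*) : Submodule ℂ (NCPoly (X ⊕ X)) :=
  Submodule.span ℂ
    {w | ∃ (a b : NCPoly X) (k : X),
      w = rename Sum.inl a * var (Sum.inr k) * rename Sum.inl b}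

/-- Substitution of the tuple `p` of polynomials in `x` for the variables `z` in `P(x, z)`. -/
def substRight (P : NCPoly (X ⊕ X)) (p : X → NCPoly X) : NCPoly X :=
  eval (Sum.elim var p) P

/-- A linear functional is positive if it is Hermitian and nonnegative on all `p p^*`
(in the order of `ℂ`, `0 ≤ w` says that `w` is real and nonnegative). -/
def IsPositive (μ : NCPoly X →ₗ[ℂ] ℂ) : Prop :=
  (∀ p, μ (star p) = star (μ p)) ∧ ∀ p, 0 ≤ μ (p * star p)

end NCPoly

open NCPoly

/-- A system of constraints `g_i(x) ≥ 0`, `h_j(x) = 0` with Hermitian polynomials `g_i`, `h_j`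
in the non-commuting variables `x`. -/
structure NCConstraints (X I J : Type*) where
  g : I → NCPoly X
  h : J → NCPoly X
  g_selfAdjoint : ∀ i, IsSelfAdjoint (g i)
  h_selfAdjoint : ∀ j, IsSelfAdjoint (h j)

namespace NCConstraints

variable {X Y Z I J I' J' : Type*}

/-- The functional `μ` is compatible with all the constraints `g_i(x) ≥ 0` and `h_j(x) = 0`. -/
def Compatible (C : NCConstraints X I J) (μ : NCPoly X →ₗ[ℂ] ℂ) : Prop :=
  (∀ i p, 0 ≤ μ (p * C.g i * star p)) ∧ ∀ j p q, μ (p * C.h j * q) = 0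

/-- The feasible points `σ` of the NPO problem with these constraints. -/
def IsFeasible (C : NCConstraints X I J) (σ : NCPoly X →ₗ[ℂ] ℂ) : Prop :=
  σ 1 = 1 ∧ (∀ p, 0 ≤ σ (p * star p)) ∧ C.Compatible σ

/-- `σ` solves the NPO problem of minimizing `σ(f)` subject to these constraints. For Hermitian
`f` and feasible `σ` the number `σ(f)` is real. -/
def IsMinimizer (C : NCConstraints X I J) (f : NCPoly X) (σ : NCPoly X →ₗ[ℂ] ℂ) : Prop :=
  C.IsFeasible σ ∧ ∀ τ, C.IsFeasible τ → (σ f).re ≤ (τ f).re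

/-- The polynomials with an SOS decomposition
`∑ s^* s + ∑ s^* g_i s + ∑ (s⁺ h_j (s⁻)^* + s⁻ h_j (s⁺)^*)` (finite sums). -/
def sos (C : NCConstraints X I J) : AddSubmonoid (NCPoly X) :=
  AddSubmonoid.closure
    ({p | ∃ s, p = star s * s} ∪ {p | ∃ i s, p = star s * C.g i * s} ∪
      {p | ∃ j s t, p = s * C.h j * star t + t * C.h j * star s})

/-- The two-sided ideal of all finite sums of terms `v h_j w`. -/
def ideal (C : NCConstraints X I J) : Submodule ℂ (NCPoly X) :=
  Submodule.span ℂ {p | ∃ j v w, p = v * C.h j * w}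

/-- The Archimedean property: `K - ∑ x_i²` has an SOS decomposition for some `K > 0`. -/
def IsArchimedean [Fintype X] (C : NCConstraints X I J) : Prop :=
  ∃ K : ℝ, 0 < K ∧ algebraMap ℂ (NCPoly X) (K : ℂ) - ∑ k, var k ^ 2 ∈ C.sos

/-- The equality constraints have linearly independent gradients. The tuple written `P₀` on
paper is `P none`, and the tuple `P_j` is `P (some j)`. -/
def LinIndepGradients [Fintype J] (C : NCConstraints X I J) : Prop :=
  ∃ P : Option J → X → NCPoly (X ⊕ X),
    (∀ a k, IsSelfAdjoint (P a k) ∧ P a k ∈ linearInRight X) ∧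
    (∀ (p : X → NCPoly X) (k : X), ∑ a, substRight (P a k) p - p k ∈ C.ideal) ∧
    (∀ (j : J) (a : Option J), a ≠ some j → ∀ p : X → NCPoly X,
      grad (C.h j) (fun k => substRight (P a k) p) ∈ C.ideal) ∧
    ∀ (j : J) (k : X), ∃ (L : ℕ) (β γ : Fin L → NCPoly X), ∀ p : X → NCPoly X,
      substRight (P (some j) k) p -
        ∑ l, (β l * grad (C.h j) p * star (γ l) + γ l * grad (C.h j) p * star (β l)) ∈ C.ideal

/-- The non-commutative Mangasarian-Fromovitz constraint qualification. -/
def NcMFCQ [Fintype J] (C : NCConstraints X I J) : Prop :=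
  C.LinIndepGradients ∧
    ∃ (r : ℝ) (q : X → NCPoly X) (s : I → NCPoly X), 0 < r ∧ (∀ k, IsSelfAdjoint (q k)) ∧
      (∀ i, grad (C.g i) q + s i * C.g i + C.g i * star (s i) -
        algebraMap ℂ (NCPoly X) (r : ℂ) ∈ C.sos) ∧
      ∀ j, grad (C.h j) q ∈ C.ideal

/-- The constraints in the variables `x = (y, z)` which consist of a system `A` of constraints on
`y` alone, a system `B` of constraints on `z` alone and the commutation relations
`[y_r, z_s] = 0` for all `r`, `s`, written with the Hermitian polynomial `i [y_r, z_s]`. -/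
def commutingJoin (A : NCConstraints Y I J) (B : NCConstraints Z I' J') :
    NCConstraints (Y ⊕ Z) (I ⊕ I') ((J ⊕ J') ⊕ (Y × Z)) where
  g := Sum.elim (fun i => rename Sum.inl (A.g i)) (fun i => rename Sum.inr (B.g i))
  h := Sum.elim
    (Sum.elim (fun j => rename Sum.inl (A.h j)) (fun j => rename Sum.inr (B.h j)))
    (fun rs => Complex.I • (var (Sum.inl rs.1) * var (Sum.inr rs.2) -
      var (Sum.inr rs.2) * var (Sum.inl rs.1)))
  g_selfAdjoint := by
    rintro (i | i)
    · exact (rename_star _ _).symm.trans (congrArg _ (A.g_selfAdjoint i))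
    · exact (rename_star _ _).symm.trans (congrArg _ (B.g_selfAdjoint i))
  h_selfAdjoint := by
    rintro ((j | j) | ⟨r, s⟩)
    · exact (rename_star _ _).symm.trans (congrArg _ (A.h_selfAdjoint j))
    · exact (rename_star _ _).symm.trans (congrArg _ (B.h_selfAdjoint j))
    · simp [isSelfAdjoint_iff, star_smul, ← smul_neg]

end NCConstraints

end

/-! A minimizer `σ` is realized by GNS as a functional `p ↦ φ(p(x))` on bounded operators `x`
(`IsFeasible.exists_representation`); the Archimedean hypothesis gives boundedness. For a Hermitian
polynomial variation `P` the equation `α' = P(α)`, `α(0) = x`, has a short-time self-adjoint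
solution (`exists_flow`), and `p ↦ φ(p(α(t)))` is a competitor once `α(t)` satisfies the
constraints. Equalities persist by Grönwall if `∇h_j(P)` lies in the ideal (`eval_h_flow_eq_zero`),
inequalities if `P` points strictly inward (`eventually_nonneg_of_hasDerivAt`). Hence `Re σ(∇f(P)) ≥
0` for such `P` (`IsMinimizer.re_grad_nonneg`). Variations of `z` by polynomials in `z` respect
`[y_r, z_s] = 0` and leave the constraints on `y` unchanged.

Hahn-Banach separation, with the ncMFCQ direction as Slater point, turns this into multipliers
`μ_i`, valid along variations tangent to the equalities (`exists_multipliers`). The residual `E =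
σ∘∇f - ∑ μ_i∘∇g_i` therefore kills the tangent piece `P_0(p)` in the splitting of `p` given by
independent gradients; each remaining piece factors through `∇h_j(p)`, which defines `λ_j`
(`LinIndepGradients.exists_equality_multipliers`). These `λ_j` are differences of positive
compatible functionals because the complex span of such functionals is stable under `μ ↦ μ(u · v)`,
by polarization (`comp_mulLR_mem_compatibleSpan`). -/

open NCPoly

noncomputable section

/-! ### Evaluation and gradients of non-commutative polynomials. -/

namespace NCPoly

variable {X Y : Type*}

section Eval

variable {A : Type*} [Ring A] [Algebra ℂ A]

theorem eval_comp {B : Type*} [Ring B] [Algebra ℂ B] (φ : A →ₐ[ℂ] B) (a : X → A) (p : NCPoly X) :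
    eval (fun k => φ (a k)) p = φ (eval a p) := by
  induction p using NCPoly.induction with
  | hs r => simp
  | hv k => simp
  | hm a b ha hb => simp [ha, hb]
  | ha a b ha hb => simp [ha, hb]

theorem eval_rename (e : X → Y) (a : Y → A) (p : NCPoly X) :
    eval a (rename e p) = eval (fun k => a (e k)) p := by
  rw [rename, ← eval_comp]
  simp

theorem eval_star [StarRing A] [StarModule ℂ A] {a : X → A} (ha : ∀ k, IsSelfAdjoint (a k))
    (p : NCPoly X) : eval a (star p) = star (eval a p) := by
  induction p using NCPoly.induction with
  | hs r => simp [← algebraMap_star_comm]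
  | hv k => simp [(ha k).star_eq]
  | hm a b ha hb => simp [ha, hb]
  | ha a b ha hb => simp [ha, hb]

theorem eval_isSelfAdjoint [StarRing A] [StarModule ℂ A] {a : X → A}
    (ha : ∀ k, IsSelfAdjoint (a k)) {p : NCPoly X} (hp : IsSelfAdjoint p) :
    IsSelfAdjoint (eval a p) := by
  rw [isSelfAdjoint_iff, ← eval_star ha, hp.star_eq]

end Eval

section Grad

variable (t : X → NCPoly X)

/-- Setting `ε = 0` is an algebra map that fixes the variables. This turns multiplication of dual
numbers into the Leibniz rule for `grad`. -/
theorem fst_eval_dualNumber (p : NCPoly X) :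
    (eval (A := DualNumber (NCPoly X))
      (fun k => TrivSqZeroExt.inl (var k) + TrivSqZeroExt.inr (t k)) p).fst = p := by
  induction p using NCPoly.induction with
  | hs r => simp [TrivSqZeroExt.algebraMap_eq_inl']
  | hv k => simp
  | hm a b ha hb => rw [map_mul, TrivSqZeroExt.fst_mul, ha, hb]
  | ha a b ha hb => rw [map_add, TrivSqZeroExt.fst_add, ha, hb]

@[simp]
theorem grad_algebraMap (r : ℂ) : grad (algebraMap ℂ (NCPoly X) r) t = 0 := by
  simp [grad, TrivSqZeroExt.algebraMap_eq_inl']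

@[simp]
theorem grad_var (k : X) : grad (var k) t = t k := by
  simp [grad]

@[simp]
theorem grad_add (a b : NCPoly X) : grad (a + b) t = grad a t + grad b t := by
  simp [grad]

@[simp]
theorem grad_mul (a b : NCPoly X) : grad (a * b) t = grad a t * b + a * grad b t := by
  rw [grad, map_mul, TrivSqZeroExt.snd_mul, fst_eval_dualNumber, fst_eval_dualNumber, add_comm]
  rfl

@[simp]
theorem grad_smul (r : ℂ) (a : NCPoly X) : grad (r • a) t = r • grad a t := by
  simp [Algebra.smul_def]

@[simp]
theorem grad_sub (a b : NCPoly X) : grad (a - b) t = grad a t - grad b t := by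
  simp [grad]

theorem grad_star (a : NCPoly X) :
    grad (star a) (fun k => star (t k)) = star (grad a t) := by
  induction a using NCPoly.induction with
  | hs r => simp [star_algebraMap']
  | hv k => simp
  | hm a b ha hb => simp [ha, hb, add_comm]
  | ha a b ha hb => simp [ha, hb]

theorem grad_isSelfAdjoint {a : NCPoly X} (ha : IsSelfAdjoint a) {t : X → NCPoly X}
    (ht : ∀ k, IsSelfAdjoint (t k)) : IsSelfAdjoint (grad a t) := by
  have := grad_star t a
  simp only [(ht _).star_eq, ha.star_eq] at this
  exact this.symm

/-- The gradient of `p` as a linear function of the tuple of variations. -/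
def gradLin (p : NCPoly X) : (X → NCPoly X) →ₗ[ℂ] NCPoly X where
  toFun t := grad p t
  map_add' s t := by
    induction p using NCPoly.induction with
    | hs r => simp
    | hv k => simp
    | hm a b ha hb => simp only [grad_mul, ha, hb]; noncomm_ring
    | ha a b ha hb => simp only [grad_add, ha, hb]; abel
  map_smul' c t := by
    induction p using NCPoly.induction with
    | hs r => simp
    | hv k => simp
    | hm a b ha hb => simp_all
    | ha a b ha hb => simp_all

@[simp]
theorem gradLin_apply (p : NCPoly X) : gradLin p t = grad p t := rfl

theorem grad_rename (e : X → Y) (s : Y → NCPoly Y) (hs : ∀ k, s (e k) = rename e (t k))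
    (p : NCPoly X) : grad (rename e p) s = rename e (grad p t) := by
  induction p using NCPoly.induction with
  | hs r => simp
  | hv k => simp [hs]
  | hm a b ha hb => simp [ha, hb]
  | ha a b ha hb => simp [ha, hb]

theorem grad_rename_eq_zero (e : X → Y) (s : Y → NCPoly Y) (hs : ∀ k, s (e k) = 0)
    (p : NCPoly X) : grad (rename e p) s = 0 := by
  rw [grad_rename (fun _ => 0) e s (by simpa using hs)]
  exact (congrArg (rename e) (gradLin p).map_zero).trans (map_zero _)

end Grad

end NCPoly

/-! ### The constraint ideal, SOS polynomials and the commuting join. -/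

namespace NCConstraints

variable {X Y Z I J I' J' : Type*} (C : NCConstraints X I J)

theorem mul_mem_ideal (a b : NCPoly X) {p : NCPoly X} (hp : p ∈ C.ideal) :
    a * p * b ∈ C.ideal := by
  induction hp using Submodule.span_induction with
  | mem x hx =>
    obtain ⟨j, v, w, rfl⟩ := hx
    exact Submodule.subset_span ⟨j, a * v, w * b, by noncomm_ring⟩
  | zero => simp
  | add x y _ _ hx hy => rw [mul_add, add_mul]; exact add_mem hx hy
  | smul c x _ hx => rw [mul_smul_comm, smul_mul_assoc]; exact Submodule.smul_mem _ _ hx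

theorem mul_mem_ideal_left (a : NCPoly X) {p : NCPoly X} (hp : p ∈ C.ideal) :
    a * p ∈ C.ideal := by simpa using C.mul_mem_ideal a 1 hp

theorem mul_mem_ideal_right (b : NCPoly X) {p : NCPoly X} (hp : p ∈ C.ideal) :
    p * b ∈ C.ideal := by simpa using C.mul_mem_ideal 1 b hp

theorem h_mem_ideal (j : J) : C.h j ∈ C.ideal :=
  Submodule.subset_span ⟨j, 1, 1, by simp⟩

theorem star_mem_ideal {p : NCPoly X} (hp : p ∈ C.ideal) : star p ∈ C.ideal := by
  induction hp using Submodule.span_induction with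
  | mem x hx =>
    obtain ⟨j, v, w, rfl⟩ := hx
    refine Submodule.subset_span ⟨j, star w, star v, ?_⟩
    simp [(C.h_selfAdjoint j).star_eq, mul_assoc]
  | zero => simp
  | add x y _ _ hx hy => rw [star_add]; exact add_mem hx hy
  | smul c x _ hx => rw [star_smul]; exact Submodule.smul_mem _ _ hx

theorem Compatible.eq_zero_of_mem_ideal {μ : NCPoly X →ₗ[ℂ] ℂ} {C : NCConstraints X I J}
    (hμ : C.Compatible μ) {p : NCPoly X} (hp : p ∈ C.ideal) : μ p = 0 := by
  have : C.ideal ≤ LinearMap.ker μ := Submodule.span_le.2 <| by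
    rintro _ ⟨j, v, w, rfl⟩
    exact hμ.2 j v w
  exact this hp

section Eval

variable {A : Type*} [Ring A] [Algebra ℂ A] {C}

theorem eval_nonneg_of_mem_sos [StarRing A] [StarModule ℂ A] [PartialOrder A] [StarOrderedRing A]
    {a : X → A} (hsa : ∀ k, IsSelfAdjoint (a k)) (hg : ∀ i, 0 ≤ eval a (C.g i))
    (ha : ∀ j, eval a (C.h j) = 0) {p : NCPoly X} (hp : p ∈ C.sos) : 0 ≤ eval a p := by
  induction hp using AddSubmonoid.closure_induction with
  | mem x hx =>
    rcases hx with (⟨s, rfl⟩ | ⟨i, s, rfl⟩) | ⟨j, s, t, rfl⟩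
    · simp [eval_star hsa]
    · simpa [eval_star hsa] using star_left_conjugate_nonneg (hg i) _
    · simp [ha]
  | zero => simp
  | add x y _ _ hx hy => simpa using add_nonneg hx hy

end Eval

/-- Conjugation by `a` preserves each kind of SOS generator. The conjugated form is what bounds
operators on every GNS vector `a`, not only on the class of `1`. -/
theorem apply_conj_nonneg_of_mem_sos {σ : NCPoly X →ₗ[ℂ] ℂ} {C : NCConstraints X I J}
    (hσ : C.IsFeasible σ) {p : NCPoly X} (hp : p ∈ C.sos) (a : NCPoly X) :
    0 ≤ σ (star a * p * a) := by
  induction hp using AddSubmonoid.closure_induction with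
  | mem x hx =>
    rcases hx with (⟨s, rfl⟩ | ⟨i, s, rfl⟩) | ⟨j, s, t, rfl⟩
    · simpa [mul_assoc] using hσ.2.1 (star a * star s)
    · simpa [mul_assoc] using hσ.2.2.1 i (star a * star s)
    · have h1 := hσ.2.2.2 j (star a * s) (star t * a)
      have h2 := hσ.2.2.2 j (star a * t) (star s * a)
      rw [mul_add, add_mul, map_add]
      simp only [← mul_assoc] at h1 h2 ⊢
      simp [h1, h2]
  | zero => simp
  | add x y _ _ hx hy => rw [mul_add, add_mul, map_add]; exact add_nonneg hx hy

section Join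

variable (A : NCConstraints Y I J) (B : NCConstraints Z I' J')

theorem rename_mem_ideal_commutingJoin {p : NCPoly Z} (hp : p ∈ B.ideal) :
    rename Sum.inr p ∈ (commutingJoin A B).ideal := by
  induction hp using Submodule.span_induction with
  | mem x hx =>
    obtain ⟨j, v, w, rfl⟩ := hx
    exact Submodule.subset_span ⟨Sum.inl (Sum.inr j), rename Sum.inr v, rename Sum.inr w, by
      simp [commutingJoin]⟩
  | zero => simp
  | add x y _ _ hx hy => rw [map_add]; exact add_mem hx hy
  | smul c x _ hx => rw [map_smul]; exact Submodule.smul_mem _ _ hx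

/-- The commutator with `y_r` is a derivation in `p`, so the case of a single variable `z_s`
suffices. -/
theorem commutator_mem_ideal_commutingJoin (r : Y) (p : NCPoly Z) :
    var (Sum.inl r) * rename Sum.inr p - rename Sum.inr p * var (Sum.inl r) ∈
      (commutingJoin A B).ideal := by
  induction p using NCPoly.induction with
  | hs r => simp [Algebra.commutes]
  | hv k =>
    have h := (commutingJoin A B).h_mem_ideal (Sum.inr (r, k))
    have h2 := Submodule.smul_mem _ (-Complex.I) h
    simpa [commutingJoin, smul_smul] using h2
  | hm a b ha hb =>
    have h := add_mem ((commutingJoin A B).mul_mem_ideal_right (rename Sum.inr b) ha)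
      ((commutingJoin A B).mul_mem_ideal_left (rename Sum.inr a) hb)
    convert h using 1
    rw [map_mul]; noncomm_ring
  | ha a b ha hb =>
    convert add_mem ha hb using 1
    rw [map_add]; noncomm_ring

/-- Variations of the variables `z` by polynomials in `z`, as variations of all variables. -/
def extendVariation (Y : Type*) {Z : Type*} (p : Z → NCPoly Z) : Y ⊕ Z → NCPoly (Y ⊕ Z) :=
  Sum.elim (fun _ => 0) (fun k => rename Sum.inr (p k))

@[simp]
theorem grad_rename_inr_extendVariation (a : NCPoly Z) (p : Z → NCPoly Z) :
    grad (rename Sum.inr a) (extendVariation Y p) = rename Sum.inr (grad a p) :=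
  grad_rename p Sum.inr (extendVariation Y p) (fun _ => rfl) a

@[simp]
theorem grad_rename_inl_extendVariation (a : NCPoly Y) (p : Z → NCPoly Z) :
    grad (rename Sum.inl a) (extendVariation Y p) = 0 :=
  grad_rename_eq_zero Sum.inl (extendVariation Y p) (fun _ => rfl) a

/-- The relation `i[y_r, z_s]` has gradient `i[y_r, p_s(z)]`, which lies in the ideal because `p_s`
involves `z` only. -/
theorem grad_h_commutingJoin_mem_ideal {p : Z → NCPoly Z} (hp : ∀ j, grad (B.h j) p ∈ B.ideal)
    (j : (J ⊕ J') ⊕ (Y × Z)) :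
    grad ((commutingJoin A B).h j) (extendVariation Y p) ∈ (commutingJoin A B).ideal := by
  rcases j with (j | j) | ⟨r, s⟩
  · simp [commutingJoin]
  · simpa [commutingJoin] using rename_mem_ideal_commutingJoin A B (hp j)
  · have h := commutator_mem_ideal_commutingJoin A B r (p s)
    simpa [commutingJoin, extendVariation] using Submodule.smul_mem _ Complex.I h

theorem star_extendVariation (p : Z → NCPoly Z) :
    (fun k => star (extendVariation Y p k)) = extendVariation Y (fun k => star (p k)) := by
  ext (k | k) <;> simp [extendVariation, rename_star]

end Join

end NCConstraints

/-! ### The GNS representation. -/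

section

open scoped InnerProductSpace
open UniformSpace UniformSpace.Completion

namespace NCPoly

variable {X : Type*}

/-- Polarization: reality of `σ` on the squares of `p`, `p + 1` and `p + i` gives the imaginary and
the real part of the identity. -/
theorem map_star_of_nonneg {σ : NCPoly X →ₗ[ℂ] ℂ} (hσ : ∀ p, 0 ≤ σ (p * star p)) (p : NCPoly X) :
    σ (star p) = star (σ p) := by
  have h1 := (Complex.nonneg_iff.1 (hσ 1)).2
  have h2 := (Complex.nonneg_iff.1 (hσ p)).2
  have h3 := (Complex.nonneg_iff.1 (hσ (p + 1))).2
  have h4 := (Complex.nonneg_iff.1 (hσ (p + Complex.I • 1))).2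
  simp only [star_add, star_one, mul_add, add_mul, map_add, mul_one, one_mul, star_smul,
    mul_smul_comm, smul_mul_assoc, map_smul, smul_eq_mul, Complex.add_im, Complex.mul_im,
    RCLike.star_def, Complex.conj_I, Complex.I_re, Complex.I_im, Complex.neg_re, Complex.neg_im]
    at h1 h2 h3 h4
  simp at h1 h4
  apply Complex.ext
  · simp
    linarith
  · simp
    linarith

set_option linter.unusedVariables false in
/-- The polynomials with the semi-inner product `⟪a, b⟫ = σ (a^* b)`. -/
@[nolint unusedArguments]
def PreGNS {σ : NCPoly X →ₗ[ℂ] ℂ} (hσ : ∀ p, 0 ≤ σ (p * star p)) : Type _ := NCPoly X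

variable {σ : NCPoly X →ₗ[ℂ] ℂ} (hσ : ∀ p, 0 ≤ σ (p * star p))

instance : AddCommGroup (PreGNS hσ) := inferInstanceAs (AddCommGroup (NCPoly X))
instance : Module ℂ (PreGNS hσ) := inferInstanceAs (Module ℂ (NCPoly X))

/-- The class of a polynomial in the GNS space. -/
def toPreGNS : NCPoly X ≃ₗ[ℂ] PreGNS hσ := LinearEquiv.refl ℂ _

/-- The semi-inner product of the GNS construction. -/
abbrev preGNSCore : PreInnerProductSpace.Core ℂ (PreGNS hσ) where
  inner a b := σ (star ((toPreGNS hσ).symm a) * (toPreGNS hσ).symm b)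
  conj_inner_symm a b := by
    rw [← Complex.star_def, ← map_star_of_nonneg hσ, star_mul, star_star]
  re_inner_nonneg a := by
    have := hσ (star ((toPreGNS hσ).symm a))
    rw [star_star] at this
    exact (Complex.nonneg_iff.1 this).1
  add_left _ _ _ := by rw [map_add, star_add, add_mul, map_add]
  smul_left := by simp

instance : SeminormedAddCommGroup (PreGNS hσ) :=
  InnerProductSpace.Core.toSeminormedAddCommGroup (c := preGNSCore hσ)
instance : InnerProductSpace ℂ (PreGNS hσ) := InnerProductSpace.ofCore (preGNSCore hσ)

theorem inner_toPreGNS (a b : NCPoly X) :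
    ⟪toPreGNS hσ a, toPreGNS hσ b⟫_ℂ = σ (star a * b) := rfl

variable {hσ}

/-- Left multiplication by a variable on the GNS space. -/
def leftMulVar {K : ℝ} {k : X} (hK : ∀ a, (σ (star a * (var k * var k) * a)).re ≤
    K * (σ (star a * a)).re) : PreGNS hσ →L[ℂ] PreGNS hσ :=
  ((toPreGNS hσ).toLinearMap ∘ₗ LinearMap.mulLeft ℂ (var k) ∘ₗ
    (toPreGNS hσ).symm.toLinearMap).mkContinuous √K fun a => by
      obtain ⟨a, rfl⟩ := (toPreGNS hσ).surjective a
      have h1 : ‖toPreGNS hσ (var k * a)‖ ^ 2 ≤ K * ‖toPreGNS hσ a‖ ^ 2 := by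
        rw [← inner_self_eq_norm_sq (𝕜 := ℂ), ← inner_self_eq_norm_sq (𝕜 := ℂ), inner_toPreGNS,
          inner_toPreGNS]
        simpa [mul_assoc] using hK a
      have h2 : ‖toPreGNS hσ (var k * a)‖ ≤ √(K * ‖toPreGNS hσ a‖ ^ 2) := Real.le_sqrt_of_sq_le h1
      rwa [Real.sqrt_mul' _ (by positivity), Real.sqrt_sq (norm_nonneg _)] at h2

@[simp]
theorem leftMulVar_toPreGNS {K : ℝ} {k : X} (hK : ∀ a, (σ (star a * (var k * var k) * a)).re ≤
    K * (σ (star a * a)).re) (a : NCPoly X) :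
    leftMulVar (hσ := hσ) hK (toPreGNS hσ a) = toPreGNS hσ (var k * a) := rfl

end NCPoly

namespace NCConstraints

variable {X I J : Type*} [Fintype X] {C : NCConstraints X I J}

/-- `K - x_k²` exceeds the SOS polynomial `K - ∑ x_l²` by the squares of the other variables. -/
theorem IsArchimedean.exists_bound (hC : C.IsArchimedean) {σ : NCPoly X →ₗ[ℂ] ℂ}
    (hσ : C.IsFeasible σ) : ∃ K : ℝ, ∀ k a, (σ (star a * (var k * var k) * a)).re ≤
      K * (σ (star a * a)).re := by
  obtain ⟨K, -, hK⟩ := hC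
  refine ⟨K, fun k a => ?_⟩
  have h1 := (Complex.nonneg_iff.1 (apply_conj_nonneg_of_mem_sos hσ hK a)).1
  have h2 : ∀ l, 0 ≤ (σ (star a * (var l * var l) * a)).re := fun l => by
    have := (Complex.nonneg_iff.1 (hσ.2.1 (star a * var l))).1
    simpa [mul_assoc] using this
  have h3 := Finset.single_le_sum (fun l _ => h2 l) (Finset.mem_univ k)
  have h4 : (σ (star a * (algebraMap ℂ (NCPoly X) (K : ℂ)) * a)).re = K * (σ (star a * a)).re := by
    rw [← Algebra.commutes, mul_assoc, ← Algebra.smul_def]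
    simp
  rw [mul_sub, sub_mul, map_sub, Complex.sub_re, h4, Finset.mul_sum, Finset.sum_mul, map_sum,
    Complex.re_sum] at h1
  simp only [pow_two] at h1
  linarith

/-- The Gelfand-Naimark-Segal representation of a feasible point of an Archimedean problem. -/
theorem IsFeasible.exists_representation.{u} {X : Type u} [Fintype X] {C : NCConstraints X I J}
    (hC : C.IsArchimedean) {σ : NCPoly X →ₗ[ℂ] ℂ} (hσ : C.IsFeasible σ) :
    ∃ (A : Type u) (_ : CStarAlgebra A) (_ : PartialOrder A) (_ : StarOrderedRing A)
      (x : X → A) (φ : A →L[ℂ] ℂ), (∀ k, IsSelfAdjoint (x k)) ∧ (∀ a, 0 ≤ a → 0 ≤ φ a) ∧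
        (∀ p, φ (eval x p) = σ p) ∧ (∀ i, 0 ≤ eval x (C.g i)) ∧ ∀ j, eval x (C.h j) = 0 := by
  obtain ⟨K, hK⟩ := hC.exists_bound hσ
  have hpos : ∀ p, 0 ≤ σ (p * star p) := hσ.2.1
  -- The completion is Hausdorff, so null vectors are collapsed without a separate quotient.
  let H := Completion (PreGNS hpos)
  let ι : NCPoly X → H := fun a => (toPreGNS hσ.2.1 a : H)
  have hι : ∀ a b, ⟪ι a, ι b⟫_ℂ = σ (star a * b) := fun a b =>
    (inner_coe _ _).trans (inner_toPreGNS _ a b)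
  let x : X → H →L[ℂ] H := fun k => (leftMulVar (hσ := hpos) (hK k)).completion
  have hx : ∀ k a, x k (ι a) = ι (var k * a) := fun k a =>
    ContinuousLinearMap.completion_apply_coe _ _
  have hsa : ∀ k, IsSelfAdjoint (x k) := fun k => by
    rw [ContinuousLinearMap.isSelfAdjoint_iff']
    symm
    rw [ContinuousLinearMap.eq_adjoint_iff]
    intro v w
    induction v, w using Completion.induction_on₂ with
    | hp => apply isClosed_eq <;> fun_prop
    | ih a b =>
      obtain ⟨a, rfl⟩ := (toPreGNS hpos).surjective a
      obtain ⟨b, rfl⟩ := (toPreGNS hpos).surjective b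
      change ⟪x k (ι a), ι b⟫_ℂ = ⟪ι a, x k (ι b)⟫_ℂ
      rw [hx, hx, hι, hι]
      simp [mul_assoc]
  have heval : ∀ p a, eval x p (ι a) = ι (p * a) := fun p => by
    induction p using NCPoly.induction with
    | hs r =>
      intro a
      rw [AlgHom.commutes, ← Algebra.smul_def]
      simp [ι, Algebra.algebraMap_eq_smul_one]
    | hv k => intro a; simp [hx]
    | hm p q hp hq => intro a; simp [hp, hq, mul_assoc]
    | ha p q hp hq => intro a; simp [hp, hq, add_mul, ι, Completion.coe_add]
  let φ : (H →L[ℂ] H) →L[ℂ] ℂ :=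
    (innerSL ℂ (ι 1)).comp (ContinuousLinearMap.apply ℂ H (ι 1))
  refine ⟨H →L[ℂ] H, inferInstance, inferInstance, inferInstance, x, φ, hsa, ?_, ?_, ?_, ?_⟩
  · intro a ha
    rw [ContinuousLinearMap.nonneg_iff_isPositive] at ha
    exact ha.inner_nonneg_right _
  · intro p
    change ⟪ι 1, eval x p (ι 1)⟫_ℂ = _
    rw [heval, hι]
    simp
  · intro i
    rw [ContinuousLinearMap.nonneg_iff_isPositive, ContinuousLinearMap.isPositive_iff']
    refine ⟨eval_isSelfAdjoint hsa (C.g_selfAdjoint i), fun v => ?_⟩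
    have hcl : IsClosed {z : ℂ | 0 ≤ z} := isClosed_Ici
    induction v using Completion.induction_on with
    | hp => exact hcl.preimage (by fun_prop)
    | ih a =>
      obtain ⟨a, rfl⟩ := (toPreGNS hpos).surjective a
      change 0 ≤ ⟪eval x (C.g i) (ι a), ι a⟫_ℂ
      rw [heval, hι]
      have := hσ.2.2.1 i (star a)
      simpa [(C.g_selfAdjoint i).star_eq] using this
  · intro j
    ext v
    induction v using Completion.induction_on with
    | hp => apply isClosed_eq <;> fun_prop
    | ih a =>
      obtain ⟨a, rfl⟩ := (toPreGNS hpos).surjective a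
      change eval x (C.h j) (ι a) = 0
      -- The squared norm of `h_j a` is `σ(a^* h_j h_j a)`, which vanishes by compatibility.
      rw [heval, ← inner_self_eq_zero (𝕜 := ℂ), hι]
      have := hσ.2.2.2 j (star a) (C.h j * a)
      simpa [(C.h_selfAdjoint j).star_eq, mul_assoc] using this

end NCConstraints

end

/-! ### Polynomial flows and first-order optimality. -/

section

open Set Filter Topology

namespace NCPoly

variable {X : Type*} {A : Type*}

theorem contDiff_eval [NormedRing A] [NormedAlgebra ℂ A] {E : Type*} [NormedAddCommGroup E]
    [NormedSpace ℝ E] {s : E → X → A} (hs : ∀ k, ContDiff ℝ 1 fun v => s v k) (p : NCPoly X) :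
    ContDiff ℝ 1 fun v => eval (s v) p := by
  induction p using NCPoly.induction with
  | hs r => simpa using contDiff_const
  | hv k => simpa using hs k
  | hm a b ha hb => simpa using ha.mul hb
  | ha a b ha hb => simpa using ha.add hb

theorem hasDerivAt_eval [NormedRing A] [NormedAlgebra ℂ A] {α : ℝ → X → A} {P : X → NCPoly X}
    {t : ℝ} (hα : ∀ k, HasDerivAt (fun s => α s k) (eval (α t) (P k)) t) (p : NCPoly X) :
    HasDerivAt (fun s => eval (α s) p) (eval (α t) (grad p P)) t := by
  induction p using NCPoly.induction with
  | hs r => simpa using hasDerivAt_const t _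
  | hv k => simpa using hα k
  | hm a b ha hb => simpa only [map_mul, grad_mul, map_add] using! ha.mul hb
  | ha a b ha hb => simpa only [map_add, grad_add] using! ha.add hb

/-- Picard-Lindelöf for the vector field `P`, regarded over `ℝ` because the star is only
real-linear. -/
theorem exists_flow [CStarAlgebra A] [Fintype X] {P : X → NCPoly X}
    (hP : ∀ k, IsSelfAdjoint (P k)) {x : X → A} (hx : ∀ k, IsSelfAdjoint (x k)) :
    ∃ (α : ℝ → X → A) (ε : ℝ), 0 < ε ∧ α 0 = x ∧
      (∀ t ∈ Ioo (-ε) ε, ∀ k, IsSelfAdjoint (α t k)) ∧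
      ∀ t ∈ Ioo (-ε) ε, ∀ p, HasDerivAt (fun s => eval (α s) p) (eval (α t) (grad p P)) t := by
  -- Precomposing the field with the Hermitian part makes all its values self-adjoint. Then `α -
  -- α^*` has derivative zero, so the solution stays self-adjoint, where `s` is the identity.
  let s : (X → A) → X → A := fun v k => (2⁻¹ : ℝ) • (v k + star (v k))
  have hs : ∀ k, ContDiff ℝ 1 fun v => s v k := fun k => by
    have h1 : ContDiff ℝ 1 fun v : X → A => v k := contDiff_apply ℝ A k
    have h2 : ContDiff ℝ 1 fun v : X → A => star (v k) :=
      (starL' ℝ : A ≃L[ℝ] A).contDiff.comp h1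
    exact contDiff_const.smul (h1.add h2)
  have hssa : ∀ v k, IsSelfAdjoint (s v k) := fun v k =>
    IsSelfAdjoint.smul (.all _) (by simp [isSelfAdjoint_iff, add_comm])
  have hF : ContDiff ℝ 1 fun v k => eval (s v) (P k) := contDiff_pi.2 fun k => contDiff_eval hs _
  obtain ⟨α, h0, ε, hε, hα⟩ :=
    hF.contDiffAt.exists_forall_mem_closedBall_exists_eq_forall_mem_Ioo_hasDerivAt₀ (x₀ := x) 0
  simp only [zero_sub, zero_add] at hα
  have hα' : ∀ t ∈ Ioo (-ε) ε, ∀ k, HasDerivAt (fun s => α s k) (eval (s (α t)) (P k)) t :=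
    fun t ht => hasDerivAt_pi.1 (hα t ht)
  have hsa : ∀ t ∈ Ioo (-ε) ε, ∀ k, IsSelfAdjoint (α t k) := fun t ht k => by
    have hd : ∀ t ∈ Ioo (-ε) ε, HasDerivAt (fun s => α s k - star (α s k)) 0 t := fun t ht => by
      have h := (hα' t ht k).sub (hα' t ht k).star
      rwa [(eval_isSelfAdjoint (hssa _) (hP k)).star_eq, sub_self] at h
    have h := isOpen_Ioo.is_const_of_deriv_eq_zero isPreconnected_Ioo
      (fun t ht => (hd t ht).differentiableAt.differentiableWithinAt)
      (fun t ht => (hd t ht).deriv) ht ⟨neg_lt_zero.2 hε, hε⟩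
    simp only [h0, (hx k).star_eq, sub_self] at h
    exact (sub_eq_zero.1 h).symm
  refine ⟨α, ε, hε, h0, hsa, fun t ht => hasDerivAt_eval fun k => ?_⟩
  have h : s (α t) = α t := funext fun k => by
    simp only [s, (hsa t ht k).star_eq, ← two_smul ℝ (α t k), smul_smul]
    norm_num
  simpa only [h] using hα' t ht k

end NCPoly

namespace NCConstraints

variable {X I J : Type*} {A : Type*} {C : NCConstraints X I J}

/-- In a term `v h_j w` the outer factors are bounded along the curve by compactness of the time
interval. -/
theorem exists_norm_eval_le_of_mem_ideal [NormedRing A] [NormedAlgebra ℂ A] [Fintype J]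
    {α : ℝ → X → A} {b : ℝ} (hα : ∀ p, ContinuousOn (fun t => eval (α t) p) (Icc 0 b))
    {p : NCPoly X} (hp : p ∈ C.ideal) :
    ∃ K, ∀ t ∈ Icc 0 b, ‖eval (α t) p‖ ≤ K * ‖fun j => eval (α t) (C.h j)‖ := by
  induction hp using Submodule.span_induction with
  | mem p hp =>
    obtain ⟨j, v, w, rfl⟩ := hp
    obtain ⟨V, hV⟩ := isCompact_Icc.exists_bound_of_continuousOn (hα v)
    obtain ⟨W, hW⟩ := isCompact_Icc.exists_bound_of_continuousOn (hα w)
    refine ⟨V * W, fun t ht => ?_⟩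
    have h1 := norm_le_pi_norm (fun j => eval (α t) (C.h j)) j
    have hV0 := (norm_nonneg _).trans (hV t ht)
    have hW0 := (norm_nonneg _).trans (hW t ht)
    calc ‖eval (α t) (v * C.h j * w)‖
        ≤ ‖eval (α t) v‖ * ‖eval (α t) (C.h j)‖ * ‖eval (α t) w‖ := by
          rw [map_mul, map_mul]
          exact norm_mul₃_le
      _ ≤ V * ‖fun j => eval (α t) (C.h j)‖ * W := by
          gcongr
          exacts [hV t ht, hW t ht]
      _ = _ := by ring
  | zero => exact ⟨0, by simp⟩
  | add p q _ _ hp hq =>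
    obtain ⟨K, hK⟩ := hp
    obtain ⟨L, hL⟩ := hq
    refine ⟨K + L, fun t ht => ?_⟩
    rw [map_add, add_mul]
    exact (norm_add_le _ _).trans (add_le_add (hK t ht) (hL t ht))
  | smul c p _ hp =>
    obtain ⟨K, hK⟩ := hp
    refine ⟨‖c‖ * K, fun t ht => ?_⟩
    rw [map_smul, norm_smul, mul_assoc]
    gcongr
    exact hK t ht

/-- Grönwall: the derivative of the vector of values `h_j(α(t))` comes from the ideal, so it is
dominated by that vector, which starts at zero. -/
theorem eval_h_flow_eq_zero [NormedRing A] [NormedAlgebra ℂ A] [Fintype J] {α : ℝ → X → A}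
    {P : X → NCPoly X} {b : ℝ} (hP : ∀ j, grad (C.h j) P ∈ C.ideal)
    (hα : ∀ t ∈ Icc 0 b, ∀ p, HasDerivAt (fun s => eval (α s) p) (eval (α t) (grad p P)) t)
    (h0 : ∀ j, eval (α 0) (C.h j) = 0) {t : ℝ} (ht : t ∈ Icc 0 b) (j : J) :
    eval (α t) (C.h j) = 0 := by
  have hc : ∀ p, ContinuousOn (fun t => eval (α t) p) (Icc 0 b) := fun p t ht =>
    (hα t ht p).continuousAt.continuousWithinAt
  choose K hK using fun j => exists_norm_eval_le_of_mem_ideal hc (hP j)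
  have h := eq_zero_of_abs_deriv_le_mul_abs_self_of_eq_zero_right (a := 0) (b := b)
    (f := fun t j => eval (α t) (C.h j)) (f' := fun t j => eval (α t) (grad (C.h j) P))
    (K := ∑ j, |K j|) (continuousOn_pi.2 fun j => hc _)
    (fun t ht => (hasDerivAt_pi.2 fun j => hα t (Ico_subset_Icc_self ht) _).hasDerivWithinAt)
    (funext h0) (fun t ht => by
      refine (pi_norm_le_iff_of_nonneg (by positivity)).2 fun j =>
        (hK j t (Ico_subset_Icc_self ht)).trans ?_
      gcongr
      exact (le_abs_self _).trans
        (Finset.single_le_sum (f := fun j => |K j|) (fun _ _ => abs_nonneg _) (Finset.mem_univ j)))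
  exact congrFun (h t ht) j

end NCConstraints

/-- A curve of self-adjoint elements that starts at a nonnegative element in a strictly feasible
direction stays nonnegative for a while. -/
theorem eventually_nonneg_of_hasDerivAt {A : Type*} [CStarAlgebra A] [PartialOrder A]
    [StarOrderedRing A] {G : ℝ → A} {L c : A} {δ : ℝ} (hδ : 0 < δ)
    (hG : ∀ᶠ t in 𝓝 0, IsSelfAdjoint (G t)) (h0 : 0 ≤ G 0) (hL : IsSelfAdjoint L)
    (hd : HasDerivAt G L 0) (hle : algebraMap ℝ A δ ≤ L + c * G 0 + G 0 * star c) :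
    ∀ᶠ t in 𝓝[>] 0, 0 ≤ G t := by
  have h1 : ∀ᶠ t in 𝓝[>] (0 : ℝ), ‖G t - G 0 - t • L‖ ≤ δ / 2 * ‖t‖ := by
    have := (hasDerivAt_iff_isLittleO.1 hd).def (half_pos hδ)
    simp only [sub_zero] at this
    exact this.filter_mono nhdsWithin_le_nhds
  have h2 : ∀ᶠ t in 𝓝[>] (0 : ℝ), t * ‖c * G 0 * star c‖ < δ / 2 := by
    have : Tendsto (fun t : ℝ => t * ‖c * G 0 * star c‖) (𝓝 0) (𝓝 (0 * ‖c * G 0 * star c‖)) :=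
      tendsto_id.mul_const _
    rw [zero_mul] at this
    exact (this.eventually_lt_const (half_pos hδ)).filter_mono nhdsWithin_le_nhds
  filter_upwards [h1, h2, self_mem_nhdsWithin, hG.filter_mono nhdsWithin_le_nhds]
    with t h1 h2 ht hGt
  replace ht : 0 < t := ht
  -- The quadratic term completes the first-order expression to the conjugate `(1 - tc) G(0) (1 -
  -- tc)^*`; the remainder `R` is then at most `tδ` in norm and is absorbed by the strict margin.
  set R := G t - G 0 - t • L - (t ^ 2) • (c * G 0 * star c) with hR
  have hRsa : IsSelfAdjoint R :=
    ((hGt.sub (.of_nonneg h0)).sub (.smul (.all _) hL)).sub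
      (.smul (.all _) (.of_nonneg (star_right_conjugate_nonneg h0 c)))
  have hRn : ‖R‖ ≤ t * δ := by
    refine (norm_sub_le _ _).trans ?_
    rw [norm_smul, Real.norm_of_nonneg (by positivity)]
    rw [Real.norm_of_nonneg ht.le] at h1
    nlinarith
  have hR0 : 0 ≤ algebraMap ℝ A (t * δ) + R := by
    have h3 : algebraMap ℝ A ‖R‖ ≤ algebraMap ℝ A (t * δ) := algebraMap_mono A hRn
    have h4 := hRsa.neg_algebraMap_norm_le_self
    rw [neg_le_iff_add_nonneg] at h4
    exact h4.trans (by rw [add_comm]; gcongr)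
  have h5 : 0 ≤ t • (L + c * G 0 + G 0 * star c - algebraMap ℝ A δ) :=
    smul_nonneg ht.le (sub_nonneg.2 hle)
  have h6 := star_right_conjugate_nonneg h0 (1 - t • c)
  have key : G t = (1 - t • c) * G 0 * star (1 - t • c) +
      t • (L + c * G 0 + G 0 * star c - algebraMap ℝ A δ) + (algebraMap ℝ A (t * δ) + R) := by
    simp only [hR, Algebra.algebraMap_eq_smul_one, star_sub, star_one, star_smul, star_trivial,
      sub_mul, mul_sub, one_mul, mul_one, smul_mul_assoc, mul_smul_comm, smul_add, smul_sub,
      smul_smul, pow_two]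
    abel
  rw [key]
  exact add_nonneg (add_nonneg h6 h5) hR0

theorem HasDerivAt.nonneg_of_eventually_le {u : ℝ → ℝ} {u' a : ℝ} (h : HasDerivAt u u' a)
    (hu : ∀ᶠ t in 𝓝[>] a, u a ≤ u t) : 0 ≤ u' := by
  have h1 : Tendsto (slope u a) (𝓝[>] a) (𝓝 u') :=
    (hasDerivAt_iff_tendsto_slope.1 h).mono_left (nhdsWithin_mono _ fun t ht => ne_of_gt ht)
  refine ge_of_tendsto h1 ?_
  filter_upwards [hu, self_mem_nhdsWithin] with t ht hta
  rw [slope_def_field]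
  exact div_nonneg (sub_nonneg.2 ht) (sub_nonneg.2 (le_of_lt hta))

namespace NCConstraints

variable {X I J : Type*} [Fintype X] [Finite I] [Fintype J] {C : NCConstraints X I J}

/-- First-order optimality of a minimizer with respect to feasible polynomial variations. -/
theorem IsMinimizer.re_grad_nonneg {f : NCPoly X} {σ : NCPoly X →ₗ[ℂ] ℂ} (hσ : C.IsMinimizer f σ)
    {A : Type*} [CStarAlgebra A] [PartialOrder A] [StarOrderedRing A]
    {x : X → A} {φ : A →L[ℂ] ℂ} (hx : ∀ k, IsSelfAdjoint (x k)) (hφ : ∀ a, 0 ≤ a → 0 ≤ φ a)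
    (hφσ : ∀ p, φ (eval x p) = σ p) (hg : ∀ i, 0 ≤ eval x (C.g i))
    (hh : ∀ j, eval x (C.h j) = 0) {P : X → NCPoly X} (hP : ∀ k, IsSelfAdjoint (P k))
    (hPh : ∀ j, grad (C.h j) P ∈ C.ideal)
    (hPg : ∀ i, (∃ (c : A) (δ : ℝ), 0 < δ ∧ algebraMap ℝ A δ ≤
      eval x (grad (C.g i) P) + c * eval x (C.g i) + eval x (C.g i) * star c) ∨
        grad (C.g i) P = 0) :
    0 ≤ (σ (grad f P)).re := by
  obtain ⟨α, ε, hε, h0, hsa, hα⟩ := exists_flow hP hx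
  have h00 : (0 : ℝ) ∈ Ioo (-ε) ε := ⟨neg_lt_zero.2 hε, hε⟩
  have hnhds : Ioo (-ε) ε ∈ 𝓝 0 := isOpen_Ioo.mem_nhds h00
  have hge : ∀ i, ∀ᶠ t in 𝓝[>] 0, 0 ≤ eval (α t) (C.g i) := fun i => by
    rcases hPg i with ⟨c, δ, hδ, hle⟩ | hz
    · refine eventually_nonneg_of_hasDerivAt (L := eval x (grad (C.g i) P)) (c := c) hδ ?_ ?_ ?_ ?_ ?_
      · filter_upwards [hnhds] with t ht using eval_isSelfAdjoint (hsa t ht) (C.g_selfAdjoint i)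
      · rw [h0]; exact hg i
      · exact eval_isSelfAdjoint hx (grad_isSelfAdjoint (C.g_selfAdjoint i) hP)
      · have := hα 0 h00 (C.g i)
        rwa [h0] at this
      · rwa [h0]
    -- With zero gradient the constraint polynomial is constant along the flow.
    · filter_upwards [mem_nhdsWithin_of_mem_nhds hnhds] with t ht
      have h := isOpen_Ioo.is_const_of_deriv_eq_zero isPreconnected_Ioo
        (fun t ht => (hα t ht (C.g i)).differentiableAt.differentiableWithinAt)
        (fun t ht => by rw [(hα t ht (C.g i)).deriv, hz, map_zero]; rfl) ht h00
      simp only [h, h0, hg i]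
  have hmin : ∀ᶠ t in 𝓝[>] (0 : ℝ), (φ (eval (α 0) f)).re ≤ (φ (eval (α t) f)).re := by
    filter_upwards [eventually_all.2 hge, mem_nhdsWithin_of_mem_nhds hnhds, self_mem_nhdsWithin]
      with t hgt ht htpos
    rw [h0, hφσ]
    have hht : ∀ j, eval (α t) (C.h j) = 0 := fun j =>
      eval_h_flow_eq_zero (b := t) hPh
        (fun s hs => hα s ⟨h00.1.trans_le hs.1, hs.2.trans_lt ht.2⟩) (by rw [h0]; exact hh)
        ⟨le_of_lt htpos, le_rfl⟩ j
    -- The competitor keeps the functional `φ` and moves only the operators.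
    refine hσ.2 (φ.toLinearMap ∘ₗ (eval (α t)).toLinearMap) ⟨?_, fun p => ?_, fun i p => ?_,
      fun j p q => ?_⟩
    · have := hφσ 1
      simpa [hσ.1.1] using this
    · simpa [eval_star (hsa t ht)] using hφ _ (mul_star_self_nonneg _)
    · simpa [eval_star (hsa t ht)] using hφ _ (star_right_conjugate_nonneg (hgt i) _)
    · simp [hht]
  have hd : HasDerivAt (fun t => (φ (eval (α t) f)).re) (σ (grad f P)).re 0 := by
    have h1 := (Complex.reCLM.comp (φ.restrictScalars ℝ)).hasFDerivAt.comp_hasDerivAt 0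
      (hα 0 h00 f)
    rw [h0] at h1
    rw [← hφσ]
    exact h1
  exact hd.nonneg_of_eventually_le hmin

end NCConstraints

end

/-! ### Lagrange multipliers on a C*-algebra. -/

section

open Set

section Multipliers

variable {A : Type*} [CStarAlgebra A] [PartialOrder A] {ι : Type*}

/-- The elements whose real part is bounded below by a positive constant, up to terms which
vanish in every state that vanishes at `g`. -/
def strictCone (g : A) : Set A :=
  {a | ∃ (c : A) (δ : ℝ), 0 < δ ∧ algebraMap ℝ A δ ≤ (realPart a : A) + c * g + g * star c}

theorem one_mem_strictCone (g : A) : 1 ∈ strictCone g :=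
  ⟨0, 1, one_pos, by simp⟩

variable [StarOrderedRing A]

theorem smul_mem_strictCone {g a : A} (ha : a ∈ strictCone g) {r : ℝ} (hr : 0 < r) :
    r • a ∈ strictCone g := by
  obtain ⟨c, δ, hδ, h⟩ := ha
  refine ⟨r • c, r * δ, mul_pos hr hδ, ?_⟩
  have := smul_le_smul_of_nonneg_left h hr.le
  rw [map_mul, ← Algebra.smul_def, map_smul]
  simpa [smul_add] using this

/-- Adding an element whose real part is nonnegative up to a multiple of `g`. -/
theorem add_mem_strictCone {g a b c : A} (ha : a ∈ strictCone g)
    (hb : 0 ≤ (realPart b : A) + c * g + g * star c) : a + b ∈ strictCone g := by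
  obtain ⟨d, δ, hδ, h⟩ := ha
  refine ⟨d + c, δ, hδ, ?_⟩
  have h2 := add_le_add h hb
  rw [add_zero] at h2
  refine h2.trans_eq ?_
  simp only [map_add, AddSubgroup.coe_add, star_add, add_mul, mul_add]
  abel

theorem convex_strictCone (g : A) : Convex ℝ (strictCone g) := by
  refine convex_iff_forall_pos.2 fun a ha b hb r s hr hs _ => ?_
  obtain ⟨c, δ, hδ, h⟩ := smul_mem_strictCone hb hs
  exact add_mem_strictCone (smul_mem_strictCone ha hr)
    ((algebraMap_nonneg A hδ.le).trans h)

/-- A perturbation of norm below `δ/2` lowers the real part by at most `δ/2`, leaving half of the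
margin. -/
theorem isOpen_strictCone (g : A) : IsOpen (strictCone g) := by
  refine Metric.isOpen_iff.2 fun a ⟨c, δ, hδ, h⟩ => ⟨δ / 2, half_pos hδ, fun b hb => ?_⟩
  refine ⟨c, δ / 2, half_pos hδ, ?_⟩
  have h1 : ‖(realPart (b - a) : A)‖ ≤ δ / 2 :=
    (realPart.norm_le (b - a)).trans (mem_ball_iff_norm.1 hb).le
  have h2 := (realPart (b - a)).2.neg_algebraMap_norm_le_self
  have h3 := algebraMap_mono A h1
  have h4 : algebraMap ℝ A δ = algebraMap ℝ A (δ / 2) + algebraMap ℝ A (δ / 2) := by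
    rw [← map_add, add_halves]
  rw [neg_le_iff_add_nonneg] at h2
  have h5 := add_le_add h (h2.trans (add_le_add_right h3 _))
  rw [h4, add_zero] at h5
  rw [← add_le_add_iff_right (algebraMap ℝ A (δ / 2))]
  refine h5.trans_eq ?_
  simp only [map_sub, AddSubgroup.coe_sub]
  abel

/-- A number `x` is nonnegative if `c + n x` is positive for all `n`. -/
theorem nonneg_of_forall_add_mul_pos {c x : ℝ} (h : ∀ n : ℕ, 0 < c + n * x) : 0 ≤ x := by
  by_contra! hx
  obtain ⟨n, hn⟩ := exists_nat_gt (c / -x)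
  rw [div_lt_iff₀ (neg_pos.2 hx)] at hn
  linarith [h n]

/-- Existence of Lagrange multipliers on a C*-algebra under a constraint qualification of
Slater type. -/
theorem exists_multipliers [Fintype ι] {g : ι → A} (hg : ∀ i, 0 ≤ g i)
    {T : Type*} [AddCommGroup T] [Module ℂ T] (L₀ : T →ₗ[ℂ] ℂ) (L : ι → T →ₗ[ℂ] A)
    (hopt : ∀ p, (∀ i, L i p ∈ strictCone (g i)) → 0 ≤ (L₀ p).re)
    {q : T} (hq : ∀ i, L i q ∈ strictCone (g i)) :
    ∃ μ : ι → A →ₗ[ℂ] ℂ, (∀ i a, 0 ≤ a → 0 ≤ μ i a) ∧ (∀ i, μ i (g i) = 0) ∧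
      ∀ p, L₀ p = ∑ i, μ i (L i p) := by
  classical
  let S : Set (ℂ × (ι → A)) := {z : ℂ | z.re < 0} ×ˢ univ.pi fun i => strictCone (g i)
  let W : Submodule ℂ (ℂ × (ι → A)) := LinearMap.range (L₀.prod (LinearMap.pi L))
  have hSc : Convex ℝ S := (convex_halfSpace_re_lt 0).prod
    (convex_pi fun i _ => convex_strictCone (g i))
  have hSo : IsOpen S := (isOpen_lt Complex.continuous_re continuous_const).prod
    (isOpen_set_pi finite_univ fun i _ => isOpen_strictCone (g i))
  -- A common point would be a strictly feasible direction of strict descent.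
  have hdisj : Disjoint S (W : Set (ℂ × (ι → A))) := by
    refine disjoint_left.2 ?_
    rintro _ ⟨h1, h2⟩ ⟨p, rfl⟩
    exact (hopt p fun i => h2 i trivial).not_gt h1
  obtain ⟨F, u, hF, hu⟩ := RCLike.geometric_hahn_banach_open (𝕜 := ℂ) hSc hSo
    ((W.restrictScalars ℝ).convex) hdisj
  have hu0 : u ≤ 0 := by simpa using hu 0 W.zero_mem
  have hWre : ∀ w ∈ W, 0 ≤ (F w).re := fun w hw =>
    nonneg_of_forall_add_mul_pos (c := 1 - u) fun n => by
      have h : u ≤ (F ((n : ℂ) • w)).re := hu _ (W.smul_mem _ hw)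
      simp at h
      linarith
  -- `W` is a complex subspace, so the lower bound applies to `±w` and `±iw`.
  have hW : ∀ w ∈ W, F w = 0 := fun w hw => by
    have h1 := hWre w hw
    have h2 := hWre _ (W.neg_mem hw)
    have h3 := hWre _ (W.smul_mem Complex.I hw)
    have h4 := hWre _ (W.smul_mem (-Complex.I) hw)
    simp at h2 h3 h4
    exact Complex.ext (by simpa using le_antisymm h2 h1) (by simpa using le_antisymm h3 h4)
  have hneg : ∀ v ∈ S, (F v).re < 0 := fun v hv => (hF v hv).trans_le hu0
  -- Such `(z, v)` are recession directions of `S`: adding any multiple `n(z, v)` to the point `(-1,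
  -- 1)` stays in `S`, where `Re F < 0`.
  have hrec : ∀ (z : ℂ) (v : ι → A), z.re ≤ 0 →
      (∀ i, ∃ c : A, 0 ≤ (realPart (v i) : A) + c * g i + g i * star c) → (F (z, v)).re ≤ 0 := by
    intro z v hz hv
    choose c hc using hv
    have := nonneg_of_forall_add_mul_pos (c := -(F (-1, fun _ => 1)).re) (x := -(F (z, v)).re)
      fun n => by
        have hmem : ((-1, fun _ => 1) + (n : ℂ) • (z, v) : ℂ × (ι → A)) ∈ S := by
          refine ⟨?_, fun i _ => ?_⟩
          · have : (n : ℝ) * z.re ≤ 0 := mul_nonpos_of_nonneg_of_nonpos (by positivity) hz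
            simp
            linarith
          · refine add_mem_strictCone (c := (n : ℝ) • c i) (one_mem_strictCone _) ?_
            have := smul_nonneg (Nat.cast_nonneg (α := ℝ) n) (hc i)
            have h2 : ((n : ℂ) • (z, v)).2 i = (n : ℝ) • v i := by
              simp [← Complex.coe_smul]
            rw [h2, map_smul]
            simpa [smul_add] using this
        have := hneg _ hmem
        rw [map_add, map_smul] at this
        simp at this
        linarith
    linarith
  let ν : ι → A →ₗ[ℂ] ℂ := fun i =>
    -(F.toLinearMap ∘ₗ LinearMap.inr ℂ ℂ (ι → A) ∘ₗ LinearMap.single ℂ (fun _ => A) i)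
  have hν : ∀ i a, ν i a = - F (0, Pi.single i a) := fun _ _ => rfl
  have hνrec : ∀ i a (c : A), 0 ≤ (realPart a : A) + c * g i + g i * star c → 0 ≤ (ν i a).re := by
    intro i a c h
    have := hrec 0 (Pi.single i a) le_rfl fun k => by
      by_cases hk : k = i
      · subst hk
        exact ⟨c, by simpa using h⟩
      · exact ⟨0, by simp [hk]⟩
    rw [hν, Complex.neg_re]
    linarith
  have hνpos : ∀ i a, 0 ≤ a → 0 ≤ ν i a := by
    intro i a ha
    have hsa : IsSelfAdjoint a := .of_nonneg ha
    have h1 := hνrec i a 0 (by simpa [hsa.coe_realPart] using ha)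
    -- Both `ia` and `-ia` have zero real part, which forces `ν i a` to be real.
    have h2 := hνrec i (Complex.I • a) 0 (by simp [realPart_I_smul, hsa.imaginaryPart])
    have h3 := hνrec i (-(Complex.I • a)) 0 (by simp [realPart_I_smul, hsa.imaginaryPart])
    simp at h2 h3
    exact Complex.nonneg_iff.2 ⟨h1, by linarith⟩
  have hνg : ∀ i, ν i (g i) = 0 := by
    intro i
    have hsa : IsSelfAdjoint (g i) := .of_nonneg (hg i)
    have h1 := hνpos i _ (hg i)
    -- With `c = 1/2` the correction `c g + g c^*` is exactly `g`, so `-g` is admissible too: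
    -- complementary slackness.
    have h2 := hνrec i (-g i) ((2⁻¹ : ℝ) • 1) (by
      simp [hsa.coe_realPart, add_assoc, ← add_smul]
      norm_num)
    rw [map_neg, Complex.neg_re] at h2
    rw [Complex.nonneg_iff] at h1
    exact Complex.ext (by simpa using le_antisymm (by linarith) h1.1) (by simpa using h1.2.symm)
  let κ : ℂ := F (1, 0)
  have hκ : ∀ z : ℂ, F (z, 0) = z * κ := fun z => by
    rw [← smul_eq_mul, ← map_smul]
    simp
  have hF' : ∀ z v, F (z, v) = z * κ - ∑ i, ν i (v i) := fun z v => by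
    have hv : ((z, v) : ℂ × (ι → A)) = (z, 0) + ∑ i, (0, Pi.single i (v i)) := by
      ext
      · simp [Prod.fst_sum]
      · simp [Prod.snd_sum]
    rw [hv, map_add, map_sum, hκ]
    simp [hν]
  have hκ0 : 0 < κ := by
    have h1 := hrec (-1) 0 (by simp) fun i => ⟨0, by simp⟩
    have h2 := hrec Complex.I 0 (by simp) fun i => ⟨0, by simp⟩
    have h3 := hrec (-Complex.I) 0 (by simp) fun i => ⟨0, by simp⟩
    rw [hκ] at h1 h2 h3
    simp at h1 h2 h3
    -- If `κ = 0`, then `F` ignores its scalar argument; at the Slater point `q` it would be both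
    -- zero, on `W`, and negative, on `S`.
    refine lt_of_le_of_ne (Complex.nonneg_iff.2 ⟨h1, by linarith⟩) fun h0 => ?_
    have h4 := hW _ ⟨q, rfl⟩
    have h5 := hneg (-1, fun i => L i q) ⟨by simp, fun i _ => hq i⟩
    have h6 : F (L₀ q, fun i => L i q) = 0 := h4
    rw [hF', ← h0] at h5 h6
    simp at h5 h6
    rw [← Complex.re_sum, h6] at h5
    simp at h5
  refine ⟨fun i => κ⁻¹ • ν i, fun i a ha => ?_, fun i => by simp [hνg], fun p => ?_⟩
  · exact mul_nonneg (inv_nonneg.2 hκ0.le) (hνpos i a ha)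
  · have h : F (L₀ p, fun i => L i p) = 0 := hW _ ⟨p, rfl⟩
    rw [hF', sub_eq_zero] at h
    simp only [LinearMap.smul_apply, smul_eq_mul, ← Finset.mul_sum, ← h]
    field_simp [hκ0.ne']

end Multipliers

end

/-! ### Hermitian parts and the span of positive compatible functionals. -/

namespace NCPoly

variable {X : Type*}

/-- The two-sided multiplication `x ↦ u x v`. -/
def mulLR (u v : NCPoly X) : NCPoly X →ₗ[ℂ] NCPoly X :=
  LinearMap.mulRight ℂ v ∘ₗ LinearMap.mulLeft ℂ u

@[simp]
theorem mulLR_apply (u v x : NCPoly X) : mulLR u v x = u * x * v := rfl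

/-- This reduces complex variations, needed for linearity over `ℂ`, to the Hermitian ones along
which flows are available. -/
theorem grad_realPart {a : NCPoly X} (ha : IsSelfAdjoint a) (t : X → NCPoly X) :
    grad a (fun k => (realPart (t k) : NCPoly X)) = realPart (grad a t) := by
  have h1 : (fun k => (realPart (t k) : NCPoly X)) =
      ((2⁻¹ : ℝ) : ℂ) • (t + fun k => star (t k)) := by
    ext k
    simp only [realPart_apply_coe, Pi.smul_apply, Pi.add_apply, Complex.coe_smul]
  have h2 := grad_star t a
  rw [ha.star_eq] at h2
  rw [h1, ← gradLin_apply, map_smul, map_add, gradLin_apply, gradLin_apply, h2, realPart_apply_coe,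
    Complex.coe_smul]

theorem IsPositive.im_apply_eq_zero {μ : NCPoly X →ₗ[ℂ] ℂ} (hμ : IsPositive μ) {a : NCPoly X}
    (ha : IsSelfAdjoint a) : (μ a).im = 0 := by
  have := hμ.1 a
  rw [ha.star_eq] at this
  exact Complex.conj_eq_iff_im.1 this.symm

theorem eval_realPart {A : Type*} [Ring A] [Algebra ℂ A] [StarRing A] [StarModule ℂ A]
    {a : X → A} (ha : ∀ k, IsSelfAdjoint (a k)) (p : NCPoly X) :
    eval a (realPart p : NCPoly X) = realPart (eval a p) := by
  rw [realPart_apply_coe, realPart_apply_coe, ← Complex.coe_smul, ← Complex.coe_smul, map_smul,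
    map_add, eval_star ha]

end NCPoly

namespace NCConstraints

variable {X Y Z I J I' J' : Type*} {C : NCConstraints X I J}

/-- The positive functionals compatible with the constraints. -/
def positiveCompatible (C : NCConstraints X I J) : AddSubmonoid (NCPoly X →ₗ[ℂ] ℂ) where
  carrier := {μ | IsPositive μ ∧ C.Compatible μ}
  zero_mem' := ⟨⟨by simp, by simp⟩, by simp, by simp⟩
  add_mem' {μ ν} hμ hν := by
    refine ⟨⟨fun p => ?_, fun p => ?_⟩, fun i p => ?_, fun j p q => ?_⟩
    · simp [hμ.1.1, hν.1.1]
    · exact add_nonneg (hμ.1.2 p) (hν.1.2 p)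
    · exact add_nonneg (hμ.2.1 i p) (hν.2.1 i p)
    · simp [hμ.2.2, hν.2.2]

theorem smul_mem_positiveCompatible {μ : NCPoly X →ₗ[ℂ] ℂ} (hμ : μ ∈ C.positiveCompatible)
    {r : ℝ} (hr : 0 ≤ r) : (r : ℂ) • μ ∈ C.positiveCompatible := by
  have hr' : (0 : ℂ) ≤ r := by exact_mod_cast hr
  refine ⟨⟨fun p => ?_, fun p => ?_⟩, fun i p => ?_, fun j p q => ?_⟩
  · simp [hμ.1.1]
  · exact mul_nonneg hr' (hμ.1.2 p)
  · exact mul_nonneg hr' (hμ.2.1 i p)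
  · simp [hμ.2.2]

theorem conj_mem_positiveCompatible {μ : NCPoly X →ₗ[ℂ] ℂ} (hμ : μ ∈ C.positiveCompatible)
    (u : NCPoly X) : μ ∘ₗ mulLR u (star u) ∈ C.positiveCompatible := by
  refine ⟨⟨fun p => ?_, fun p => ?_⟩, fun i p => ?_, fun j p q => ?_⟩
  · have := hμ.1.1 (u * p * star u)
    simpa [mul_assoc] using this
  · have := hμ.1.2 (u * p)
    simpa [mul_assoc] using this
  · have := hμ.2.1 i (u * p)
    simpa [mul_assoc] using this
  · have := hμ.2.2 j (u * p) (q * star u)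
    simpa [mul_assoc] using this

/-- The complex span of the positive functionals compatible with the constraints. -/
def compatibleSpan (C : NCConstraints X I J) : Submodule ℂ (NCPoly X →ₗ[ℂ] ℂ) :=
  Submodule.span ℂ C.positiveCompatible

theorem eq_zero_of_mem_compatibleSpan {μ : NCPoly X →ₗ[ℂ] ℂ} (hμ : μ ∈ C.compatibleSpan)
    {p : NCPoly X} (hp : p ∈ C.ideal) : μ p = 0 := by
  induction hμ using Submodule.span_induction with
  | mem μ hμ => exact hμ.2.eq_zero_of_mem_ideal hp
  | zero => simp
  | add μ ν _ _ hμ hν => simp [hμ, hν]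
  | smul c μ _ hμ => simp [hμ]

/-- Polarization: `u x v` is a quarter of the sum of `c (u + c v^*) x (u + c v^*)^*` over the fourth
roots of unity `c`, and conjugation preserves positivity and compatibility. -/
theorem comp_mulLR_mem_compatibleSpan {μ : NCPoly X →ₗ[ℂ] ℂ} (hμ : μ ∈ C.compatibleSpan)
    (u v : NCPoly X) : μ ∘ₗ mulLR u v ∈ C.compatibleSpan := by
  induction hμ using Submodule.span_induction with
  | mem μ hμ =>
    have h : ∀ c : ℂ, μ ∘ₗ mulLR (u + c • star v) (star (u + c • star v)) ∈ C.compatibleSpan :=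
      fun c => Submodule.subset_span (conj_mem_positiveCompatible hμ _)
    have h4 : μ ∘ₗ mulLR u v = (4⁻¹ : ℂ) •
        (μ ∘ₗ mulLR (u + (1 : ℂ) • star v) (star (u + (1 : ℂ) • star v)) +
        Complex.I • μ ∘ₗ mulLR (u + Complex.I • star v) (star (u + Complex.I • star v)) +
        (-1 : ℂ) • μ ∘ₗ mulLR (u + (-1 : ℂ) • star v) (star (u + (-1 : ℂ) • star v)) +
        (-Complex.I) • μ ∘ₗ
          mulLR (u + (-Complex.I) • star v) (star (u + (-Complex.I) • star v))) := by
      ext x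
      simp [mul_add, add_mul]
      ring_nf
      simp
      ring
    rw [h4]
    exact Submodule.smul_mem _ _ (add_mem (add_mem (add_mem (h _) (Submodule.smul_mem _ _ (h _)))
      (Submodule.smul_mem _ _ (h _))) (Submodule.smul_mem _ _ (h _)))
  | zero => simp
  | add μ ν _ _ hμ hν => rw [LinearMap.add_comp]; exact add_mem hμ hν
  | smul c μ _ hμ => rw [LinearMap.smul_comp]; exact Submodule.smul_mem _ _ hμ

/-- A partial gradient is a finite sum of maps `x ↦ u x v`. The induction varies `μ`, since the
Leibniz rule passes its factors on to the functional. -/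
theorem comp_gradLin_mem_compatibleSpan [DecidableEq X] (a : NCPoly X) (k : X)
    {μ : NCPoly X →ₗ[ℂ] ℂ} (hμ : μ ∈ C.compatibleSpan) :
    μ ∘ₗ gradLin a ∘ₗ LinearMap.single ℂ (fun _ => NCPoly X) k ∈ C.compatibleSpan := by
  induction a using NCPoly.induction generalizing μ with
  | hs r =>
    convert C.compatibleSpan.zero_mem
    ext x
    simp
  | hv l =>
    by_cases h : l = k
    · subst h
      convert hμ
      ext x
      simp
    · convert C.compatibleSpan.zero_mem
      ext x
      simp [h]
  | hm a b ha hb =>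
    convert add_mem (ha (comp_mulLR_mem_compatibleSpan hμ 1 b))
      (hb (comp_mulLR_mem_compatibleSpan hμ a 1))
    ext x
    simp
  | ha a b ha hb =>
    convert add_mem (ha hμ) (hb hμ)
    ext x
    simp

theorem exists_decomposition_of_mem_compatibleSpan {μ : NCPoly X →ₗ[ℂ] ℂ}
    (hμ : μ ∈ C.compatibleSpan) :
    ∃ τ : Fin 4 → NCPoly X →ₗ[ℂ] ℂ, (∀ n, τ n ∈ C.positiveCompatible) ∧
      μ = τ 0 - τ 1 + Complex.I • (τ 2 - τ 3) := by
  induction hμ using Submodule.span_induction with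
  | mem μ hμ =>
    refine ⟨![μ, 0, 0, 0], fun n => ?_, by simp⟩
    fin_cases n
    exacts [hμ, zero_mem _, zero_mem _, zero_mem _]
  | zero => exact ⟨0, fun _ => zero_mem _, by simp⟩
  | add μ ν _ _ hμ hν =>
    obtain ⟨τ, hτ, rfl⟩ := hμ
    obtain ⟨ρ, hρ, rfl⟩ := hν
    exact ⟨τ + ρ, fun n => add_mem (hτ n) (hρ n), by simp only [Pi.add_apply]; module⟩
  | smul c μ _ hμ =>
    obtain ⟨τ, hτ, rfl⟩ := hμ
    obtain ⟨a, b, a', b', ha, hb, ha', hb', hc⟩ : ∃ a b a' b' : ℝ, 0 ≤ a ∧ 0 ≤ b ∧ 0 ≤ a' ∧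
        0 ≤ b' ∧ c = (a - b) + (a' - b') * Complex.I :=
      ⟨c.re⁺, c.re⁻, c.im⁺, c.im⁻, posPart_nonneg _, negPart_nonneg _, posPart_nonneg _,
        negPart_nonneg _, by
          rw [← Complex.ofReal_sub, ← Complex.ofReal_sub, posPart_sub_negPart,
            posPart_sub_negPart, Complex.re_add_im]⟩
    have h : ∀ {r : ℝ} (n), 0 ≤ r → (r : ℂ) • τ n ∈ C.positiveCompatible := fun n hr =>
      smul_mem_positiveCompatible (hτ n) hr
    -- Multiplication by `-1` swaps the two members of each pair; multiplication by `i` moves the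
    -- real pair to the imaginary one and the imaginary pair, swapped, to the real one.
    refine ⟨![(a : ℂ) • τ 0 + (b : ℂ) • τ 1 + ((a' : ℂ) • τ 3 + (b' : ℂ) • τ 2),
      (a : ℂ) • τ 1 + (b : ℂ) • τ 0 + ((a' : ℂ) • τ 2 + (b' : ℂ) • τ 3),
      (a : ℂ) • τ 2 + (b : ℂ) • τ 3 + ((a' : ℂ) • τ 0 + (b' : ℂ) • τ 1),
      (a : ℂ) • τ 3 + (b : ℂ) • τ 2 + ((a' : ℂ) • τ 1 + (b' : ℂ) • τ 0)], fun n => ?_, ?_⟩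
    · fin_cases n <;> exact add_mem (add_mem (h _ ‹_›) (h _ ‹_›)) (add_mem (h _ ‹_›) (h _ ‹_›))
    · rw [hc]
      ext x
      simp
      linear_combination ((a' : ℂ) - b') * (τ 2 x - τ 3 x) * Complex.I_mul_I

section Join

variable {A : NCConstraints Y I J} {B : NCConstraints Z I' J'}

theorem comp_rename_mem_positiveCompatible {μ : NCPoly (Y ⊕ Z) →ₗ[ℂ] ℂ}
    (hμ : μ ∈ (commutingJoin A B).positiveCompatible) :
    μ ∘ₗ (rename Sum.inr).toLinearMap ∈ B.positiveCompatible := by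
  refine ⟨⟨fun p => ?_, fun p => ?_⟩, fun i p => ?_, fun j p q => ?_⟩
  · simpa [rename_star] using hμ.1.1 (rename Sum.inr p)
  · simpa [rename_star] using hμ.1.2 (rename Sum.inr p)
  · simpa [rename_star, commutingJoin] using hμ.2.1 (Sum.inr i) (rename Sum.inr p)
  · simpa [commutingJoin] using
      hμ.2.2 (Sum.inl (Sum.inr j)) (rename Sum.inr p) (rename Sum.inr q)

variable (Y Z) in
/-- The linear map `extendVariation`. -/
def extendVariationLin : (Z → NCPoly Z) →ₗ[ℂ] Y ⊕ Z → NCPoly (Y ⊕ Z) where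
  toFun := extendVariation Y
  map_add' p q := by ext (k | k) <;> simp [extendVariation]
  map_smul' c p := by ext (k | k) <;> simp [extendVariation]

@[simp]
theorem extendVariationLin_apply (p : Z → NCPoly Z) :
    extendVariationLin Y Z p = extendVariation Y p := rfl

theorem extendVariation_eq_sum [Fintype Z] [DecidableEq Y] [DecidableEq Z] (p : Z → NCPoly Z) :
    extendVariation Y p = ∑ k, Pi.single (Sum.inr k) (rename Sum.inr (p k)) := by
  ext (k | k)
  · simp [extendVariation, Finset.sum_apply]
  · simp [extendVariation, Finset.sum_apply, Pi.single_apply]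

end Join

end NCConstraints

/-! ### Multipliers for the constraints on `z`. -/

namespace NCConstraints

section Join

variable {Y Z I J I' J' : Type*} [Fintype Z] [Fintype J'] {A : NCConstraints Y I J} {B : NCConstraints Z I' J'}

/-- Multipliers for the inequality constraints on `z`, for variations of `z` along which the
equality constraints are preserved. -/
theorem IsMinimizer.exists_inequality_multipliers [Fintype Y] [Finite I] [Fintype J] [Fintype I']
    {f : NCPoly (Y ⊕ Z)} (hf : IsSelfAdjoint f)
    {σ : NCPoly (Y ⊕ Z) →ₗ[ℂ] ℂ} (hσ : (commutingJoin A B).IsMinimizer f σ)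
    (hArch : (commutingJoin A B).IsArchimedean) (hMF : B.NcMFCQ) :
    ∃ m : I' → NCPoly (Y ⊕ Z) →ₗ[ℂ] ℂ, (∀ i, m i ∈ (commutingJoin A B).positiveCompatible) ∧
      (∀ i, m i (rename Sum.inr (B.g i)) = 0) ∧
      ∀ p : Z → NCPoly Z, (∀ j, grad (B.h j) p ∈ B.ideal) →
        σ (grad f (extendVariation Y p)) = ∑ i, m i (rename Sum.inr (grad (B.g i) p)) := by
  obtain ⟨𝓐, _, _, _, x, φ, hx, hφ, hφσ, hg, hh⟩ := hσ.1.exists_representation hArch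
  obtain ⟨-, r, q, s, hr, hq, hgq, hhq⟩ := hMF
  have hgB : ∀ i, 0 ≤ eval x (rename Sum.inr (B.g i)) := fun i => hg (Sum.inr i)
  have hhB : ∀ j, eval x (rename Sum.inr (B.h j)) = 0 := fun j => hh (Sum.inl (Sum.inr j))
  let T : Submodule ℂ (Z → NCPoly Z) := ⨅ j, B.ideal.comap (gradLin (B.h j))
  have hT : ∀ p, p ∈ T ↔ ∀ j, grad (B.h j) p ∈ B.ideal := fun p => by simp [T]
  let L₀ : T →ₗ[ℂ] ℂ := σ ∘ₗ gradLin f ∘ₗ extendVariationLin Y Z ∘ₗ T.subtype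
  let L : I' → T →ₗ[ℂ] 𝓐 := fun i => (eval x).toLinearMap ∘ₗ (rename Sum.inr).toLinearMap ∘ₗ
    gradLin (B.g i) ∘ₗ T.subtype
  have hopt : ∀ p : T, (∀ i, L i p ∈ strictCone (eval x (rename Sum.inr (B.g i)))) →
      0 ≤ (L₀ p).re := by
    rintro ⟨p, hp⟩ hL
    let P : Z → NCPoly Z := fun k => realPart (p k)
    have hre : extendVariation Y P = fun k => (realPart (extendVariation Y p k) : NCPoly _) := by
      ext (k | k)
      · simp [extendVariation]
      · simp only [extendVariation, P, Sum.elim_inr, realPart_apply_coe, ← Complex.coe_smul,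
          map_smul, map_add, rename_star]
    have hPsa : ∀ k, IsSelfAdjoint (extendVariation Y P k) := fun k => by
      rw [hre]
      exact (realPart _).2
    have hPT : ∀ j, grad (B.h j) P ∈ B.ideal := fun j => by
      rw [grad_realPart (B.h_selfAdjoint j), realPart_apply_coe, ← Complex.coe_smul]
      exact Submodule.smul_mem _ _
        (add_mem ((hT p).1 hp j) (B.star_mem_ideal ((hT p).1 hp j)))
    have h := hσ.re_grad_nonneg hx hφ hφσ hg hh hPsa (grad_h_commutingJoin_mem_ideal A B hPT)
      fun i => by
        rcases i with i | i
        · exact .inr (grad_rename_inl_extendVariation _ _)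
        · left
          obtain ⟨c, δ, hδ, h⟩ := hL i
          refine ⟨c, δ, hδ, ?_⟩
          have h2 : eval x (grad ((commutingJoin A B).g (Sum.inr i)) (extendVariation Y P)) =
              realPart (eval x (rename Sum.inr (grad (B.g i) p))) := by
            rw [hre, grad_realPart ((commutingJoin A B).g_selfAdjoint _), eval_realPart hx]
            simp [commutingJoin]
          rw [h2]
          exact h
    -- Since `σ` is Hermitian, passing to the Hermitian part of the variation does not change the
    -- real part of the objective.
    rw [hre, grad_realPart hf, realPart_apply_coe, ← Complex.coe_smul, map_smul, map_add,
      map_star_of_nonneg hσ.1.2.1] at h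
    simp at h
    have h2 : L₀ ⟨p, hp⟩ = σ (grad f (extendVariation Y p)) := rfl
    rw [h2]
    linarith
  -- The ncMFCQ certificate, evaluated at the operators representing `z`, is the operator inequality
  -- of the strict cone, with `c = s_i(z)` and `δ = r`.
  have hLq : ∀ i, L i ⟨q, (hT q).2 hhq⟩ ∈ strictCone (eval x (rename Sum.inr (B.g i))) := by
    intro i
    refine ⟨eval x (rename Sum.inr (s i)), r, hr, ?_⟩
    have hx' : ∀ k : Z, IsSelfAdjoint (x (Sum.inr k)) := fun k => hx _
    have h := eval_nonneg_of_mem_sos hx' (fun i => by rw [← eval_rename]; exact hgB i)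
      (fun j => by rw [← eval_rename]; exact hhB j) (hgq i)
    have h2 : L i ⟨q, (hT q).2 hhq⟩ = eval x (rename Sum.inr (grad (B.g i) q)) := rfl
    have hsa : IsSelfAdjoint (eval (fun k => x (Sum.inr k)) (grad (B.g i) q)) :=
      eval_isSelfAdjoint hx' (grad_isSelfAdjoint (B.g_selfAdjoint i) hq)
    rw [h2]
    simp only [eval_rename, hsa.coe_realPart]
    rw [map_sub, sub_nonneg, map_add, map_add, map_mul, map_mul, eval_star hx',
      AlgHom.commutes] at h
    simpa [Algebra.algebraMap_eq_smul_one] using h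
  obtain ⟨μ, hμ, hμg, hμL⟩ := exists_multipliers hgB L₀ L hopt hLq
  refine ⟨fun i => μ i ∘ₗ (eval x).toLinearMap, fun i => ?_, hμg, fun p hp => hμL ⟨p, (hT p).2 hp⟩⟩
  have hpos : ∀ p, 0 ≤ μ i (eval x (p * star p)) := fun p => by
    rw [map_mul, eval_star hx]
    exact hμ i _ (mul_star_self_nonneg _)
  refine ⟨⟨map_star_of_nonneg (σ := μ i ∘ₗ (eval x).toLinearMap) hpos, hpos⟩, fun k p => ?_,
    fun j p q => ?_⟩
  · simpa [eval_star hx] using hμ i _ (star_right_conjugate_nonneg (hg k) (eval x p))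
  · simp [hh]

/-- Multipliers for the equality constraints: a functional of the variations of `z` which
vanishes along the variations preserving the equality constraints factors through the gradients
of these constraints. -/
theorem LinIndepGradients.exists_equality_multipliers [DecidableEq Y] [DecidableEq Z]
    (hB : B.LinIndepGradients)
    {E : (Y ⊕ Z → NCPoly (Y ⊕ Z)) →ₗ[ℂ] ℂ}
    (hE : ∀ k, E ∘ₗ LinearMap.single ℂ (fun _ => NCPoly (Y ⊕ Z)) (Sum.inr k) ∈
      (commutingJoin A B).compatibleSpan)
    (hE0 : ∀ p : Z → NCPoly Z, (∀ j, grad (B.h j) p ∈ B.ideal) → E (extendVariation Y p) = 0) :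
    ∃ Λ : J' → NCPoly (Y ⊕ Z) →ₗ[ℂ] ℂ, (∀ j, Λ j ∈ (commutingJoin A B).compatibleSpan) ∧
      ∀ p : Z → NCPoly Z,
        E (extendVariation Y p) = ∑ j, Λ j (rename Sum.inr (grad (B.h j) p)) := by
  obtain ⟨P, -, hsum, hne, hfac⟩ := hB
  choose N β γ hβγ using hfac
  let D : Z → NCPoly (Y ⊕ Z) →ₗ[ℂ] ℂ := fun k =>
    E ∘ₗ LinearMap.single ℂ (fun _ => NCPoly (Y ⊕ Z)) (Sum.inr k)
  have hED : ∀ p, E (extendVariation Y p) = ∑ k, D k (rename Sum.inr (p k)) := fun p => by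
    rw [extendVariation_eq_sum, map_sum]
    rfl
  have hD0 : ∀ k (a b : NCPoly Z), a - b ∈ B.ideal →
      D k (rename Sum.inr a) = D k (rename Sum.inr b) := fun k a b hab => by
    rw [← sub_eq_zero, ← map_sub, ← map_sub]
    exact eq_zero_of_mem_compatibleSpan (hE k) (rename_mem_ideal_commutingJoin A B hab)
  -- `M j k` sends `∇h_j(p)` to the `k`-th entry of `P_j(z, p)` modulo the ideal, so `λ_j` is the
  -- sum over `k` of `D k ∘ M j k`.
  let M : J' → Z → NCPoly (Y ⊕ Z) →ₗ[ℂ] NCPoly (Y ⊕ Z) := fun j k => ∑ l,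
    (mulLR (rename Sum.inr (β j k l)) (rename Sum.inr (star (γ j k l))) +
      mulLR (rename Sum.inr (γ j k l)) (rename Sum.inr (star (β j k l))))
  refine ⟨fun j => ∑ k, D k ∘ₗ M j k, fun j => sum_mem fun k _ => ?_, fun p => ?_⟩
  · have : D k ∘ₗ M j k = ∑ l,
        (D k ∘ₗ mulLR (rename Sum.inr (β j k l)) (rename Sum.inr (star (γ j k l))) +
          D k ∘ₗ mulLR (rename Sum.inr (γ j k l)) (rename Sum.inr (star (β j k l)))) := by
      ext x
      simp [M]
    rw [this]
    exact sum_mem fun l _ => add_mem (comp_mulLR_mem_compatibleSpan (hE k) _ _)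
      (comp_mulLR_mem_compatibleSpan (hE k) _ _)
  · have h1 : E (extendVariation Y p) =
        ∑ a, E (extendVariation Y fun k => substRight (P a k) p) := by
      simp only [hED]
      rw [Finset.sum_comm]
      refine Finset.sum_congr rfl fun k _ => ?_
      rw [← map_sum, ← map_sum]
      exact (hD0 k _ _ (hsum p k)).symm
    -- The piece `P_0(z, p)` is tangent to all equality constraints, so `E` vanishes on it.
    rw [h1, Fintype.sum_option, hE0 _ fun j => hne j none (by simp) p, zero_add]
    refine Finset.sum_congr rfl fun j _ => ?_
    rw [hED, LinearMap.sum_apply]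
    refine Finset.sum_congr rfl fun k _ => ?_
    rw [hD0 k _ _ (hβγ j k p)]
    simp [M]

end Join

end NCConstraints

/-! ### Assembly of the optimality conditions. -/

theorem mainTheorem11 {c q mY mY' mZ mZ' : ℕ}
    (f : NCPoly (Fin c ⊕ Fin q)) (hf : IsSelfAdjoint f)
    (A : NCConstraints (Fin c) (Fin mY) (Fin mY'))
    (B : NCConstraints (Fin q) (Fin mZ) (Fin mZ'))
    (hArch : (NCConstraints.commutingJoin A B).IsArchimedean)
    (hMF : B.NcMFCQ)
    (σ : NCPoly (Fin c ⊕ Fin q) →ₗ[ℂ] ℂ)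
    (hσ : (NCConstraints.commutingJoin A B).IsMinimizer f σ) :
    ∃ (μ : Fin mZ → NCPoly (Fin q) →ₗ[ℂ] ℂ)
      (lamPos lamNeg : Fin mZ' → NCPoly (Fin q) →ₗ[ℂ] ℂ),
      (∀ i, NCPoly.IsPositive (μ i) ∧ B.Compatible (μ i)) ∧
      (∀ j, NCPoly.IsPositive (lamPos j) ∧ B.Compatible (lamPos j)) ∧
      (∀ j, NCPoly.IsPositive (lamNeg j) ∧ B.Compatible (lamNeg j)) ∧
      (∀ i, μ i (B.g i) = 0) ∧
      ∀ p : Fin q → NCPoly (Fin q),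
        σ (NCPoly.grad f (Sum.elim (fun _ => 0) (fun k => NCPoly.rename Sum.inr (p k)))) -
            ∑ i, μ i (NCPoly.grad (B.g i) p) -
            ∑ j, (lamPos j - lamNeg j) (NCPoly.grad (B.h j) p) = 0 := by
  obtain ⟨m, hm, hmg, hmT⟩ := hσ.exists_inequality_multipliers hf hArch hMF
  have hσpos : σ ∈ (NCConstraints.commutingJoin A B).positiveCompatible :=
    ⟨⟨map_star_of_nonneg hσ.1.2.1, hσ.1.2.1⟩, hσ.1.2.2⟩
  let E : (Fin c ⊕ Fin q → NCPoly (Fin c ⊕ Fin q)) →ₗ[ℂ] ℂ :=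
    σ ∘ₗ gradLin f - ∑ i, m i ∘ₗ gradLin (rename Sum.inr (B.g i))
  have hEp : ∀ p : Fin q → NCPoly (Fin q), E (NCConstraints.extendVariation (Fin c) p) =
      σ (grad f (NCConstraints.extendVariation (Fin c) p)) -
        ∑ i, m i (rename Sum.inr (grad (B.g i) p)) := fun p => by
    simp [E]
  obtain ⟨Λ, hΛ, hEΛ⟩ := hMF.1.exists_equality_multipliers (A := A) (E := E)
    (fun k => by
      have h : E ∘ₗ LinearMap.single ℂ (fun _ => NCPoly (Fin c ⊕ Fin q)) (Sum.inr k) =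
          σ ∘ₗ gradLin f ∘ₗ LinearMap.single ℂ (fun _ => NCPoly (Fin c ⊕ Fin q)) (Sum.inr k) -
          ∑ i, m i ∘ₗ gradLin (rename Sum.inr (B.g i)) ∘ₗ
            LinearMap.single ℂ (fun _ => NCPoly (Fin c ⊕ Fin q)) (Sum.inr k) := by
        ext x
        simp [E]
      rw [h]
      exact sub_mem
        (NCConstraints.comp_gradLin_mem_compatibleSpan _ _ (Submodule.subset_span hσpos))
        (sum_mem fun i _ => NCConstraints.comp_gradLin_mem_compatibleSpan _ _
          (Submodule.subset_span (hm i))))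
    (fun p hp => by rw [hEp, hmT p hp, sub_self])
  choose τ hτ hΛτ using fun j =>
    NCConstraints.exists_decomposition_of_mem_compatibleSpan (hΛ j)
  have hrestr : ∀ j n, τ j n ∘ₗ (rename Sum.inr).toLinearMap ∈ B.positiveCompatible :=
    fun j n => NCConstraints.comp_rename_mem_positiveCompatible (hτ j n)
  refine ⟨fun i => m i ∘ₗ (rename Sum.inr).toLinearMap,
    fun j => τ j 0 ∘ₗ (rename Sum.inr).toLinearMap, fun j => τ j 1 ∘ₗ (rename Sum.inr).toLinearMap,
    fun i => NCConstraints.comp_rename_mem_positiveCompatible (hm i), fun j => hrestr j 0,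
    fun j => hrestr j 1, hmg, ?_⟩
  let G : (Fin q → NCPoly (Fin q)) →ₗ[ℂ] ℂ :=
    E ∘ₗ NCConstraints.extendVariationLin (Fin c) (Fin q) -
      ∑ j, (τ j 0 - τ j 1) ∘ₗ (rename Sum.inr).toLinearMap ∘ₗ gradLin (B.h j)
  have hG : ∀ p, G p = E (NCConstraints.extendVariation (Fin c) p) -
      ∑ j, (τ j 0 - τ j 1) (rename Sum.inr (grad (B.h j) p)) := fun p => by simp [G]
  -- On Hermitian variations all the functionals involved take real values, so the part `i(τ 2 - τ
  -- 3)` of each `Λ j` contributes only to the imaginary part and may be dropped. Complex linearity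
  -- then covers every `p`.
  have hGsa : ∀ p : Fin q → NCPoly (Fin q), (∀ k, IsSelfAdjoint (p k)) → G p = 0 := by
    intro p hp
    have hext : ∀ k, IsSelfAdjoint (NCConstraints.extendVariation (Fin c) p k) := fun k => by
      have h := NCConstraints.star_extendVariation (Y := Fin c) p
      simp only [(hp _).star_eq] at h
      exact congrFun h k
    have hsa : ∀ {a : NCPoly (Fin q)}, IsSelfAdjoint a →
        IsSelfAdjoint (rename Sum.inr a : NCPoly (Fin c ⊕ Fin q)) := fun {a} ha => by
      rw [isSelfAdjoint_iff, ← rename_star, ha.star_eq]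
    have hτim : ∀ j n, (τ j n (rename Sum.inr (grad (B.h j) p))).im = 0 := fun j n =>
      (hτ j n).1.im_apply_eq_zero (hsa (grad_isSelfAdjoint (B.h_selfAdjoint j) hp))
    have him : (G p).im = 0 := by
      rw [hG, hEp]
      simp [hτim, hσpos.1.im_apply_eq_zero (grad_isSelfAdjoint hf hext),
        fun i => (hm i).1.im_apply_eq_zero (hsa (grad_isSelfAdjoint (B.g_selfAdjoint i) hp))]
    have hre : (G p).re = 0 := by
      rw [hG, hEΛ, ← Finset.sum_sub_distrib]
      simp [hΛτ, hτim]
    exact Complex.ext hre him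
  intro p
  have hp : p = (fun k => (realPart (p k) : NCPoly (Fin q))) +
      Complex.I • fun k => (imaginaryPart (p k) : NCPoly (Fin q)) :=
    funext fun k => (realPart_add_I_smul_imaginaryPart (p k)).symm
  have h0 : G p = 0 := by
    rw [hp, map_add, map_smul, hGsa _ fun k => (realPart (p k)).2,
      hGsa _ fun k => (imaginaryPart (p k)).2]
    simp
  rw [hG, hEp] at h0
  exact h0

end
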